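/- Fix a prime $p$. Structures have as universe a subset of $\omega$. A structure is computable (relative to $X$) if its atomic diagram (the set of Gödel numbers of the atomic and negated atomic sentences, with constants for the elements, that are true in it) is computable (relative to $X$), and $a$ is an index of a computable structure $\mathcal A$ if the $a$-th c.e. set $W_a$ is the atomic diagram of $\mathcal A$. We then write $\mathcal A_a=\mathcal A$. For a class $K$ of computable structures let $I(K)$ be the set of indices of members of $K$, and let $E(K)=\{(a,b) : a,b\in I(K),\ \mathcal A_a\cong\mathcal A_b\}$. For an Abelian $p$-group $G$ put $G_0=G$, $G_{\beta+1}=pG_\beta$, and $G_\beta=\bigcap_{\gamma<\beta}G_\gamma$ for limit $\beta$. The length $\lambda(G)$ is the least $\beta$ with $G_\beta=G_{\beta+1}$, and $G$ is reduced if $G_{\lambda(G)}=0$. With $P_\beta(G)=\{x\in G_\beta : px=0\}$, the Ulm invariant $u_\beta(G)$ is the dimension of $P_\beta(G)/P_{\beta+1}(G)$ over $\mathbb Z/p\mathbb Z$. Let $K_\omega$ be the class of computable reduced Abelian $p$-groups of length at most $\omega$, and let $G^\omega=\bigoplus_{k\in\omega}\bigoplus_{i\in\omega}\mathbb Z/p^{k+1}\mathbb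 Z$. For sets $A\subseteq B$, say that $A$ is $\Pi^0_3$ complete within $B$ if $A=R\cap B$ for some $\Pi^0_3$ set $R$ and, for every $\Pi^0_3$ set $S\subseteq\omega$, there is a computable $f:\omega\to B$ such that $n\in S\iff f(n)\in A$ for all $n$. Then: 1. $E(K_\omega)$ is $\Pi^0_3$ complete within $I(K_\omega)\times I(K_\omega)$. 2. $G^\omega$ is a countable reduced Abelian $p$-group with $u_\beta(G^\omega)=\aleph_0$ for all $\beta<\omega$ and $u_\beta(G^\omega)=0$ for all $\beta\ge\omega$. For every $X\subseteq\omega$ and every set $S\subseteq\omega$ that is $\Pi^0_3$ relative to $X$, there is a uniformly $X$-computable sequence $(H^n)_{n\in\omega}$ of reduced Abelian $p$-groups of length at most $\omega$ (that is, the atomic diagram of $H^n$ is decidable from $X$ uniformly in $n$) such that, for all $n$, $H^n\cong G^\omega$ if and only if $n\in S$. -/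

import Mathlib

open Ordinal

noncomputable section

namespace UlmGroups

/-! ### Abelian `p`-groups, the transfinite sequence `G_β`, length, and Ulm invariants -/

section Groups

universe u

variable (p : ℕ) (G : Type u) [AddCommGroup G]

/-- Every element has order a power of `p`. -/
def IsAbelianPGroup : Prop := ∀ x : G, ∃ k : ℕ, p ^ k • x = 0

/-- The sequence `G_0 = G`, `G_{β+1} = p G_β`, and `G_β = ⋂_{γ < β} G_γ` for limit `β`. -/
def subgroupSeq (β : Ordinal.{u}) : AddSubgroup G :=
  Ordinal.limitRecOn β ⊤ (fun _ H => H.map (nsmulAddMonoidHom p))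
    (fun β _ H => ⨅ γ : Set.Iio β, H γ.1 γ.2)

theorem subgroupSeq_zero : subgroupSeq p G 0 = ⊤ := by
  simp [subgroupSeq]

theorem subgroupSeq_add_one (β : Ordinal.{u}) :
    subgroupSeq p G (β + 1) = (subgroupSeq p G β).map (nsmulAddMonoidHom p) := by
  simp [subgroupSeq]

theorem subgroupSeq_limit (β : Ordinal.{u}) (h : Order.IsSuccLimit β) :
    subgroupSeq p G β = ⨅ γ : Set.Iio β, subgroupSeq p G γ.1 := by
  unfold subgroupSeq
  rw [Ordinal.limitRecOn_limit (h := h)]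

theorem subgroupSeq_add_one_le (β : Ordinal.{u}) :
    subgroupSeq p G (β + 1) ≤ subgroupSeq p G β := by
  rw [subgroupSeq_add_one]
  rintro _ ⟨x, hx, rfl⟩
  exact AddSubgroup.nsmul_mem _ hx p

theorem subgroupSeq_antitone : Antitone (subgroupSeq p G) := by
  intro α β h
  induction β using Ordinal.limitRecOn with
  | zero =>
    obtain rfl : α = 0 := by simpa using h
    exact le_rfl
  | add_one β ih =>
    rcases h.lt_or_eq with h | rfl
    · exact (subgroupSeq_add_one_le p G β).trans (ih (Order.lt_add_one_iff.1 h))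
    · exact le_rfl
  | limit β hβ _ =>
    rcases h.lt_or_eq with h | rfl
    · rw [subgroupSeq_limit p G β hβ]
      exact iInf_le (fun γ : Set.Iio β => subgroupSeq p G γ.1) ⟨α, h⟩
    · exact le_rfl

/-- The sequence `G_β` is eventually constant, so that the length below is an actual minimum. -/
theorem exists_subgroupSeq_stable :
    {β : Ordinal.{u} | subgroupSeq p G β = subgroupSeq p G (β + 1)}.Nonempty := by
  by_contra hne
  rw [Set.not_nonempty_iff_eq_empty, Set.eq_empty_iff_forall_notMem] at hne
  have hlt : ∀ β : Ordinal.{u}, subgroupSeq p G (β + 1) < subgroupSeq p G β := fun β =>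
    lt_of_le_of_ne (subgroupSeq_add_one_le p G β) fun h => hne β h.symm
  have hanti : StrictAnti (subgroupSeq p G) := fun α β h =>
    (subgroupSeq_antitone p G (Order.add_one_le_of_lt h)).trans_lt (hlt α)
  exact not_injective_of_ordinal (subgroupSeq p G) hanti.injective

/-- The length `λ(G)`: the least ordinal `β` with `G_β = G_{β+1}`. -/
def length : Ordinal.{u} :=
  sInf {β : Ordinal.{u} | subgroupSeq p G β = subgroupSeq p G (β + 1)}

/-- `G` is reduced if `G_{λ(G)} = 0`. -/
def IsReducedGroup : Prop := subgroupSeq p G (length p G) = ⊥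

/-- The subgroup `P_β(G)` of those `x ∈ G_β` with `p x = 0`. -/
def socleSeq (β : Ordinal.{u}) : AddSubgroup G :=
  (nsmulAddMonoidHom (α := G) p).ker ⊓ subgroupSeq p G β

/-- The quotient `P_β(G) / P_{β+1}(G)`. -/
abbrev UlmQuotient (β : Ordinal.{u}) : Type u :=
  socleSeq p G β ⧸ (socleSeq p G (β + 1)).addSubgroupOf (socleSeq p G β)

theorem nsmul_ulmQuotient (β : Ordinal.{u}) (x : UlmQuotient p G β) : p • x = 0 := by
  induction x using QuotientAddGroup.induction_on with
  | H x =>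
    have hx : p • x = 0 := Subtype.ext x.2.1
    rw [← QuotientAddGroup.mk_nsmul, hx, QuotientAddGroup.mk_zero]

/-- The Ulm invariant `u_β(G)`: the dimension of `P_β(G) / P_{β+1}(G)` over `ℤ/pℤ`. -/
def ulmInvariant (β : Ordinal.{u}) : Cardinal.{u} :=
  letI : Module (ZMod p) (UlmQuotient p G β) :=
    AddCommGroup.zmodModule (nsmul_ulmQuotient p G β)
  Module.rank (ZMod p) (UlmQuotient p G β)

/-- The reduced Abelian `p`-groups of length at most `ω`. -/
def IsReducedPGroupOfLengthLeOmega : Prop :=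
  IsAbelianPGroup p G ∧ IsReducedGroup p G ∧ length p G ≤ ω

end Groups

/-- The direct sum of countably many copies of `ℤ/p^(k+1)ℤ` for every `k`. -/
abbrev GOmega (p : ℕ) : Type := DirectSum (ℕ × ℕ) fun i => ZMod (p ^ (i.1 + 1))

/-! ### Atomic diagrams of Abelian groups whose universe is a set of natural numbers -/

/-- An Abelian group whose universe is a set of natural numbers. -/
structure NatGroup where
  carrier : Set ℕ
  [group : AddCommGroup carrier]

attribute [instance] NatGroup.group

/-- Closed terms in the language `{0, -, +}` with a constant for every element of `α`. -/
inductive GTerm (α : Type) : Type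
  | const (a : α) : GTerm α
  | zero : GTerm α
  | neg (t : GTerm α) : GTerm α
  | add (s t : GTerm α) : GTerm α

/-- The value of a closed term. -/
def GTerm.eval {α : Type} [AddCommGroup α] : GTerm α → α
  | .const a => a
  | .zero => 0
  | .neg t => -t.eval
  | .add s t => s.eval + t.eval

/-- The Gödel number of a closed term. -/
def GTerm.code {C : Set ℕ} : GTerm C → ℕ
  | .const a => Nat.pair 0 a
  | .zero => Nat.pair 1 0
  | .neg t => Nat.pair 2 t.code
  | .add s t => Nat.pair 3 (Nat.pair s.code t.code)

/-- Atomic sentences and negations of atomic sentences. -/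
inductive Literal (α : Type) : Type
  | eq (s t : GTerm α) : Literal α
  | ne (s t : GTerm α) : Literal α

/-- Truth of a literal. -/
def Literal.Holds {α : Type} [AddCommGroup α] : Literal α → Prop
  | .eq s t => s.eval = t.eval
  | .ne s t => s.eval ≠ t.eval

/-- The Gödel numbering of closed terms is injective. -/
theorem GTerm.code_injective {C : Set ℕ} : Function.Injective (GTerm.code (C := C)) := by
  intro s
  induction s with
  | const a =>
    intro t h
    cases t <;> simp_all [GTerm.code, Nat.pair_eq_pair, Subtype.ext_iff]
  | zero =>
    intro t h
    cases t <;> simp_all [GTerm.code, Nat.pair_eq_pair]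
  | neg s ih =>
    intro t h
    cases t <;> simp only [GTerm.code, Nat.pair_eq_pair] at h <;> try omega
    rw [ih h.2]
  | add s₁ s₂ ih₁ ih₂ =>
    intro t h
    cases t <;> simp only [GTerm.code, Nat.pair_eq_pair] at h <;> try omega
    rw [ih₁ h.2.1, ih₂ h.2.2]

/-- The Gödel number of a literal. -/
def Literal.code {C : Set ℕ} : Literal C → ℕ
  | .eq s t => Nat.pair 0 (Nat.pair s.code t.code)
  | .ne s t => Nat.pair 1 (Nat.pair s.code t.code)

/-- The Gödel numbering of literals is injective. -/
theorem Literal.code_injective {C : Set ℕ} : Function.Injective (Literal.code (C := C)) := by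
  rintro (⟨s, t⟩ | ⟨s, t⟩) (⟨s', t'⟩ | ⟨s', t'⟩) h <;>
    simp [Literal.code, Nat.pair_eq_pair, GTerm.code_injective.eq_iff] at h ⊢ <;> exact h

/-- The atomic diagram, as a set of Gödel numbers: all atomic and negated atomic sentences with
constants from the universe that are true in `A`. -/
def NatGroup.diagram (A : NatGroup) : Set ℕ :=
  {k | ∃ φ : Literal A.carrier, φ.Holds ∧ φ.code = k}

/-- A structure is computable if its atomic diagram is. In particular its universe, which consists
of the `n` for which the sentence `n = n` is in the diagram, is then computable. -/
def NatGroup.IsComputable (A : NatGroup) : Prop := ComputablePred (· ∈ A.diagram)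

/-! ### Relative computability and the class `Π⁰₃` -/

/-- The oracle given by (the characteristic function of) a set `X`. -/
def oracle (X : Set ℕ) : ℕ →. ℕ :=
  open Classical in fun n => Part.some (if n ∈ X then 1 else 0)

/-- The predicate `P` is decidable relative to the oracle `X`. -/
def ComputablePredIn {α : Type} [Primcodable α] (X : Set ℕ) (P : α → Prop) : Prop :=
  open Classical in ComputableIn {oracle X} fun a => decide (P a)

/-- `S` is `Π⁰₃`. -/
def IsPi03 {α : Type} [Primcodable α] (S : Set α) : Prop :=
  ∃ R : α × ℕ × ℕ × ℕ → Prop, ComputablePred R ∧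
    ∀ a, a ∈ S ↔ ∀ x, ∃ y, ∀ z, R (a, x, y, z)

/-- `S` is `Π⁰₃` relative to `X`. -/
def IsPi03In {α : Type} [Primcodable α] (X : Set ℕ) (S : Set α) : Prop :=
  ∃ R : α × ℕ × ℕ × ℕ → Prop, ComputablePredIn X R ∧
    ∀ a, a ∈ S ↔ ∀ x, ∃ y, ∀ z, R (a, x, y, z)

/-- A sequence of groups is uniformly `X`-computable if the atomic diagrams of its members are
decidable relative to `X`, uniformly in the index. -/
def UniformlyComputableIn (X : Set ℕ) (H : ℕ → NatGroup) : Prop :=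
  ComputablePredIn X fun q : ℕ × ℕ => q.2 ∈ (H q.1).diagram

/-! ### Index sets, isomorphism problems, and completeness within a set -/

/-- The `a`-th computably enumerable set `W_a`. -/
def W (a : ℕ) : Set ℕ := {k | ((Denumerable.ofNat Nat.Partrec.Code a).eval k).Dom}

/-- `a` is an index of the computable structure `A`, i.e. `W_a` is the atomic diagram of `A`. -/
def IsIndexOf (a : ℕ) (A : NatGroup) : Prop := A.IsComputable ∧ W a = A.diagram

/-- The set `I(K)` of indices of computable members of `K`. -/
def indexSet (K : Set NatGroup) : Set ℕ := {a | ∃ A ∈ K, IsIndexOf a A}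

/-- The isomorphism problem `E(K)`: pairs of indices of isomorphic computable members of `K`. -/
def isoProblem (K : Set NatGroup) : Set (ℕ × ℕ) :=
  {q | ∃ A ∈ K, ∃ B ∈ K, IsIndexOf q.1 A ∧ IsIndexOf q.2 B ∧
    Nonempty (A.carrier ≃+ B.carrier)}

/-- `A` is `Π⁰₃` within `B`. -/
def IsPi03Within {α : Type} [Primcodable α] (A B : Set α) : Prop :=
  ∃ R : Set α, IsPi03 R ∧ A = R ∩ B

/-- `S ≤ₘ A` within `B`. -/
def ReducibleWithin {α : Type} [Primcodable α] (S : Set ℕ) (A B : Set α) : Prop :=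
  ∃ f : ℕ → α, Computable f ∧ (∀ n, f n ∈ B) ∧ ∀ n, n ∈ S ↔ f n ∈ A

/-- `A` is `Π⁰₃` complete within `B`. -/
def IsPi03CompleteWithin {α : Type} [Primcodable α] (A B : Set α) : Prop :=
  IsPi03Within A B ∧ ∀ S : Set ℕ, IsPi03 S → ReducibleWithin S A B

/-- The class `K_ω` of computable reduced Abelian `p`-groups of length at most `ω`. -/
def KOmega (p : ℕ) : Set NatGroup :=
  {A | A.IsComputable ∧ IsReducedPGroupOfLengthLeOmega p A.carrier}

end UlmGroups

end

/-! Upper bound. An Abelian `p`-group is reduced of length at most `ω` exactly when no nonzero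
element is divisible by all powers of `p`. If countable, it is then a direct sum of cyclic groups
(Prüfer): the socle has a basis adapted to the filtration by height, and dividing the basis elements
by `p` as often as possible yields generators (`exists_filtered_basis`, `exists_cyclicSum_equiv`).
So the numbers of summands of each order decide isomorphism. Having at least `m` summands of order
`p^(k+1)` means having `p^m` elements of `P_k` that are distinct modulo `P_{k+1}`
(`hasSeparatedFamily_cyclicSum_iff`). Over an enumeration of the diagram this is `Σ⁰₂`: guess the
elements, wait for the torsion equations to appear, and demand that no congruence ever appears.
Equivalence of two `Σ⁰₂` conditions for all `k` and `N` is `Π⁰₃`.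

Hardness. Given `∀ x, ∃ y, ∀ z, R`, search for `y` separately for each `x`; a witness exists iff the
search rejects only finitely many candidates. Let `v` code a pair `(l, s)`, and ask that `s` be the
first stage from which on no search with `x < l` rejects. This is a `Π⁰₁` condition on `v`, at most
one `s` works for each `l`, and it holds for infinitely many `v` iff every search settles
(`infinite_lastChange_iff`). Thus `n ∈ S` iff `∀ z, ¬Q (n, v, z)` holds for infinitely many `v`.

The group for `n` has a summand of order `p^(k+1)` for each pair `(k, v)` with `k ≥ 1`, and for each
`(0, v)` a summand that has order `p` unless some `Q (n, v, z)` holds, and order `p^2` otherwise.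
Only the number of summands of order `p` is in question, and it is infinite iff `n ∈ S`
(`presentedGroup_equiv_gOmega_iff`). The group is a subgroup of a fixed group with computable
operations, enumerable from the oracle; tagging each element with the first stage at which it is
seen to belong makes the universe decidable (`uniformlyComputableIn_presentedGroup`). -/

noncomputable section

namespace UlmGroups

/-! ### Length at most `ω` and elements of infinite height -/

section Length

universe u

variable {p : ℕ} {G : Type u} [AddCommGroup G]

theorem mem_subgroupSeq_natCast (n : ℕ) {x : G} :
    x ∈ subgroupSeq p G n ↔ ∃ y, p ^ n • y = x := by
  induction n generalizing x with
  | zero => simp [subgroupSeq_zero]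
  | succ n ih =>
    rw [Nat.cast_succ, subgroupSeq_add_one, AddSubgroup.mem_map]
    constructor
    · rintro ⟨w, hw, rfl⟩
      obtain ⟨y, rfl⟩ := ih.1 hw
      exact ⟨y, by simp [pow_succ', mul_smul]⟩
    · rintro ⟨y, rfl⟩
      exact ⟨p ^ n • y, ih.2 ⟨y, rfl⟩, by simp [pow_succ', mul_smul]⟩

theorem mem_subgroupSeq_omega0 {x : G} :
    x ∈ subgroupSeq p G ω ↔ ∀ n : ℕ, ∃ y, p ^ n • y = x := by
  rw [subgroupSeq_limit p G ω isSuccLimit_omega0, AddSubgroup.mem_iInf]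
  constructor
  · intro h n
    exact (mem_subgroupSeq_natCast n).1 (h ⟨n, natCast_lt_omega0 n⟩)
  · rintro h ⟨γ, hγ⟩
    obtain ⟨n, rfl⟩ := lt_omega0.1 hγ
    exact (mem_subgroupSeq_natCast n).2 (h n)

variable (p G) in
/-- No nonzero element is divisible by all powers of `p`. -/
def IsPSeparated : Prop := ∀ x : G, (∀ n : ℕ, ∃ y, p ^ n • y = x) → x = 0

theorem isPSeparated_iff : IsPSeparated p G ↔ subgroupSeq p G ω = ⊥ := by
  rw [AddSubgroup.eq_bot_iff_forall]
  exact forall_congr' fun x => by rw [mem_subgroupSeq_omega0]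

theorem subgroupSeq_length :
    subgroupSeq p G (length p G) = subgroupSeq p G (length p G + 1) :=
  csInf_mem (exists_subgroupSeq_stable p G)

theorem subgroupSeq_eq_of_length_le {β : Ordinal.{u}} (h : length p G ≤ β) :
    subgroupSeq p G β = subgroupSeq p G (length p G) := by
  induction β using Ordinal.limitRecOn with
  | zero => rw [nonpos_iff_eq_zero.1 h]
  | add_one β ih =>
    rcases h.lt_or_eq with h | h
    · rw [subgroupSeq_add_one, ih (Order.lt_add_one_iff.1 h), ← subgroupSeq_add_one,
        ← subgroupSeq_length]
    · rw [h]
  | limit β hβ ih =>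
    rcases h.lt_or_eq with h | h
    · refine le_antisymm (subgroupSeq_antitone p G h.le) ?_
      rw [subgroupSeq_limit p G β hβ]
      refine le_iInf fun γ => ?_
      rcases le_total (length p G) γ.1 with h' | h'
      · exact (ih γ.1 γ.2 h').ge
      · exact subgroupSeq_antitone p G h'
    · rw [h]

/-- The sequence `G_β` is constant from `λ(G)` on, so `λ(G) ≤ ω` and `G_{λ(G)} = 0` together amount
to `G_ω = 0`. -/
theorem isReducedPGroupOfLengthLeOmega_iff :
    IsReducedPGroupOfLengthLeOmega p G ↔ IsAbelianPGroup p G ∧ IsPSeparated p G := by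
  rw [isPSeparated_iff]
  refine and_congr_right fun _ => ⟨fun ⟨h, hl⟩ => ?_, fun h => ?_⟩
  · rw [subgroupSeq_eq_of_length_le hl, h]
  · have hl : length p G ≤ ω := csInf_le' <| by
      rw [Set.mem_ofPred_eq, subgroupSeq_add_one, h, AddSubgroup.map_bot]
    exact ⟨by rw [IsReducedGroup, ← subgroupSeq_eq_of_length_le hl, h], hl⟩

variable (p G) in
/-- There are `N` elements of `P_k(G)` that are pairwise distinct modulo `P_{k+1}(G)`. -/
def HasSeparatedFamily (k N : ℕ) : Prop :=
  ∃ y : Fin N → G, (∀ i, p ^ (k + 1) • y i = 0) ∧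
    ∀ i j, i ≠ j → ∀ z, p ^ k • y i ≠ p ^ k • y j + p ^ (k + 1) • z

theorem HasSeparatedFamily.map {H : Type*} [AddCommGroup H] (e : G ≃+ H) {k N : ℕ}
    (h : HasSeparatedFamily p G k N) : HasSeparatedFamily p H k N := by
  obtain ⟨y, hy, hz⟩ := h
  refine ⟨fun i => e (y i), fun i => by rw [← map_nsmul, hy, map_zero], fun i j hij z h => ?_⟩
  refine hz i j hij (e.symm z) (e.injective ?_)
  simpa using h

theorem hasSeparatedFamily_congr {H : Type*} [AddCommGroup H] (e : G ≃+ H) {k N : ℕ} :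
    HasSeparatedFamily p G k N ↔ HasSeparatedFamily p H k N :=
  ⟨.map e, .map e.symm⟩

theorem IsAbelianPGroup.map {H : Type*} [AddCommGroup H] (e : G ≃+ H)
    (h : IsAbelianPGroup p G) : IsAbelianPGroup p H := fun x => by
  obtain ⟨k, hk⟩ := h (e.symm x)
  exact ⟨k, e.symm.injective (by simpa using hk)⟩

theorem IsPSeparated.map {H : Type*} [AddCommGroup H] (e : G ≃+ H)
    (h : IsPSeparated p G) : IsPSeparated p H := fun x hx => by
  refine e.symm.injective ?_
  rw [map_zero]
  refine h _ fun n => ?_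
  obtain ⟨y, rfl⟩ := hx n
  exact ⟨e.symm y, by simp⟩

end Length

/-! ### Bases adapted to a filtration -/

/-- A countable vector space over a finite field with a separated descending filtration has a basis
that is adapted to the filtration. -/
theorem exists_filtered_basis {K V : Type*} [Field K] [Finite K] [AddCommGroup V] [Module K V]
    [Countable V] (P : ℕ → Submodule K V) (hP : Antitone P) (h0 : P 0 = ⊤)
    (hsep : ∀ x, (∀ k, x ∈ P k) → x = 0) :
    ∃ (I : Set ℕ) (b : Module.Basis I K V) (h : I → ℕ),
      ∀ k x, x ∈ P k ↔ ∀ i, b.repr x i ≠ 0 → k ≤ h i := by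
  obtain ⟨x, hx⟩ := exists_surjective_nat V
  set F : ℕ → Submodule K V := fun n => Submodule.span K (x '' Set.Iio n) with hF
  have hFfin : ∀ n, Finite (F n) := fun n => by
    have : Module.Finite K (F n) :=
      Module.Finite.span_of_finite K ((Set.finite_Iio n).image x)
    exact Module.finite_of_finite K
  have hFmono : Monotone F := fun m n hmn =>
    Submodule.span_mono (Set.image_mono (Set.Iio_subset_Iio hmn))
  have hxF : ∀ {m n}, m < n → x m ∈ F n := fun hmn =>
    Submodule.subset_span ⟨_, hmn, rfl⟩
  let I : Set ℕ := {n | x n ∉ F n}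
  -- Since `F n` is finite and the filtration is separated, the heights of the elements of `x n + F
  -- n` are bounded, and `f` is chosen to attain the maximum. The least level missed by the whole
  -- coset is positive because `P 0 = ⊤`, so `h` is its predecessor.
  have key : ∀ n : I, ∃ f ∈ F n, ∃ h, x n + f ∈ P h ∧ ∀ f ∈ F n, x n + f ∉ P (h + 1) := by
    rintro ⟨n, hn⟩
    have h1 : ∀ f : F n, ∃ k, x n + f ∉ P k := fun f => by
      by_contra! hc
      have := hsep _ hc
      exact hn ((eq_neg_of_add_eq_zero_left this) ▸ (F n).neg_mem f.2)
    choose k hk using h1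
    have := hFfin n
    obtain ⟨M, hM⟩ := Set.Finite.bddAbove (Set.finite_range k)
    have hex : ∃ h, ∀ f ∈ F n, x n + f ∉ P h := ⟨M, fun f hf hm =>
      hk ⟨f, hf⟩ (hP (hM ⟨⟨f, hf⟩, rfl⟩) hm)⟩
    classical
    have hspec := Nat.find_spec hex
    have hne : Nat.find hex ≠ 0 := fun h => by
      rw [h] at hspec
      exact hspec 0 (F n).zero_mem (h0 ▸ Submodule.mem_top)
    obtain ⟨h, hh⟩ := Nat.exists_eq_succ_of_ne_zero hne
    have := Nat.find_min hex (m := h) (by omega)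
    push Not at this
    obtain ⟨f, hf, hf'⟩ := this
    exact ⟨f, hf, h, hf', by rwa [hh] at hspec⟩
  choose f hf h hfh hmax using key
  set b : I → V := fun n => x n + f n with hb
  have hbF : ∀ {n : I} {m : ℕ}, (n : ℕ) < m → b n ∈ F m := fun {n m} hnm =>
    (F m).add_mem (hxF hnm) (hFmono hnm.le (hf n))
  -- Heights cannot rise by cancellation. If the leading index `a` had `h a < k`, dividing by its
  -- coefficient would give an element of `x a + F a` of height above the maximum `h a`; so the
  -- leading term lies in `P k` and can be split off.
  have indep : ∀ c : I →₀ K, ∀ k, Finsupp.linearCombination K b c ∈ P k →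
      ∀ n, c n ≠ 0 → k ≤ h n := by
    intro c
    induction c using Finsupp.induction_on_max with
    | zero => simp
    | single_add a r c hc hr ih =>
      intro k hk n hn
      have hca : c a = 0 := by
        by_contra hne
        exact lt_irrefl _ (hc a (Finsupp.mem_support_iff.2 hne))
      rw [map_add, Finsupp.linearCombination_single] at hk
      have hcF : Finsupp.linearCombination K b c ∈ F a := by
        rw [Finsupp.linearCombination_apply]
        exact Submodule.sum_mem _ fun i hi => Submodule.smul_mem _ _ (hbF (hc i hi))
      have hka : k ≤ h a := by
        by_contra! hlt
        refine hmax a (f a + r⁻¹ • Finsupp.linearCombination K b c)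
          ((F a).add_mem (hf a) ((F a).smul_mem _ hcF)) ?_
        have := hP hlt ((P k).smul_mem r⁻¹ hk)
        rwa [smul_add, inv_smul_smul₀ hr, hb, add_assoc] at this
      have hcP : Finsupp.linearCombination K b c ∈ P k := by
        have := (P k).smul_mem r (hP hka (hfh a))
        exact ((P k).add_mem_iff_right this).1 hk
      by_cases hna : n = a
      · rwa [hna]
      · refine ih k hcP n ?_
        rwa [Finsupp.add_apply, Finsupp.single_eq_of_ne hna, zero_add] at hn
  have hli : LinearIndependent K b := by
    rw [linearIndependent_iff]
    intro c hc
    ext n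
    by_contra hne
    have := indep c (h n + 1) (by rw [hc]; exact zero_mem _) n hne
    omega
  have hspan : ⊤ ≤ Submodule.span K (Set.range b) := by
    have : ∀ n, x n ∈ Submodule.span K (Set.range b) := by
      intro n
      induction n using Nat.strong_induction_on with
      | _ n ih =>
        have hFn : F n ≤ Submodule.span K (Set.range b) := by
          rw [hF, Submodule.span_le]
          rintro _ ⟨m, hm, rfl⟩
          exact ih m hm
        by_cases hn : x n ∈ F n
        · exact hFn hn
        · have h1 : b ⟨n, hn⟩ ∈ Submodule.span K (Set.range b) :=
            Submodule.subset_span ⟨_, rfl⟩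
          exact ((Submodule.add_mem_iff_left _ (hFn (hf ⟨n, hn⟩))).1 h1)
    intro v _
    obtain ⟨n, rfl⟩ := hx v
    exact this n
  refine ⟨I, Module.Basis.mk hli hspan, h, fun k v => ⟨fun hv n hn => ?_, fun hv => ?_⟩⟩
  · refine indep ((Module.Basis.mk hli hspan).repr v) k ?_ n hn
    have hv' := (Module.Basis.mk hli hspan).linearCombination_repr v
    rw [Module.Basis.coe_mk] at hv'
    rwa [hv']
  · rw [← (Module.Basis.mk hli hspan).linearCombination_repr v, Finsupp.linearCombination_apply]
    refine Submodule.sum_mem _ fun i hi => Submodule.smul_mem _ _ ?_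
    rw [Module.Basis.mk_apply]
    exact hP (hv i (Finsupp.mem_support_iff.1 hi)) (hfh i)

/-! ### Direct sums of cyclic groups and their invariants -/

section CyclicSums

theorem mem_range_dfinsupp_mapRange {ι : Type*} {A B : ι → Type*} [∀ i, AddCommGroup (A i)]
    [∀ i, AddCommGroup (B i)] (f : ∀ i, A i →+ B i) {x : Π₀ i, B i}
    (hx : ∀ i, x i ∈ (f i).range) : x ∈ (DFinsupp.mapRange.addMonoidHom f).range := by
  classical
  choose y hy using hx
  refine ⟨DFinsupp.mk x.support fun i => y i, ?_⟩
  ext i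
  rw [DFinsupp.mapRange.addMonoidHom_apply, DFinsupp.mapRange_apply, DFinsupp.mk_apply]
  split_ifs with h
  · exact hy i
  · rw [map_zero, DFinsupp.notMem_support_iff.1 h]

variable (p : ℕ) {ι κ : Type*}

/-- The direct sum of the cyclic groups of order `p ^ (h i + 1)`. -/
abbrev CyclicSum (h : ι → ℕ) : Type _ := DirectSum ι fun i => ZMod (p ^ (h i + 1))

variable {p}

theorem CyclicSum.exists_nsmul_eq {h : ι → ℕ} (n : ℕ) {x : CyclicSum p h}
    (hx : ∀ i, ∃ z, n • z = x i) : ∃ z, n • z = x := by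
  obtain ⟨z, hz⟩ := mem_range_dfinsupp_mapRange
    (fun i => nsmulAddMonoidHom (α := ZMod (p ^ (h i + 1))) n) (x := x) hx
  exact ⟨z, hz ▸ DFinsupp.ext fun i => rfl⟩

theorem pow_nsmul_zmod_eq_zero {k m : ℕ} (hm : m ≤ k) (x : ZMod (p ^ m)) : p ^ k • x = 0 := by
  rw [_root_.nsmul_eq_mul, (ZMod.natCast_eq_zero_iff _ _).2 (pow_dvd_pow p hm), zero_mul]

theorem isAbelianPGroup_cyclicSum [Fact p.Prime] (h : ι → ℕ) :
    IsAbelianPGroup p (CyclicSum p h) := by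
  classical
  intro x
  refine ⟨x.support.sup h + 1, DFinsupp.ext fun i => ?_⟩
  rw [DFinsupp.smul_apply, DFinsupp.zero_apply]
  by_cases hi : i ∈ x.support
  · exact pow_nsmul_zmod_eq_zero (Nat.succ_le_succ (Finset.le_sup (f := h) hi)) _
  · rw [DFinsupp.notMem_support_iff.1 hi, smul_zero]

theorem isPSeparated_cyclicSum (h : ι → ℕ) : IsPSeparated p (CyclicSum p h) := by
  intro x hx
  refine DFinsupp.ext fun i => ?_
  obtain ⟨y, rfl⟩ := hx (h i + 1)
  exact pow_nsmul_zmod_eq_zero le_rfl _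

theorem natCast_mul_pow_zmod_eq {k : ℕ} (hp : p ≠ 0) {a b : ℕ}
    (h : p ^ k • (a : ZMod (p ^ (k + 1))) = p ^ k • (b : ZMod (p ^ (k + 1)))) :
    a ≡ b [MOD p] := by
  simp only [_root_.nsmul_eq_mul, ← Nat.cast_mul] at h
  rw [ZMod.natCast_eq_natCast_iff, pow_succ] at h
  exact Nat.ModEq.mul_left_cancel' (pow_ne_zero _ hp) h

/-- An element killed by `p^(k+1)` is a multiple of `p^(n-k)`, hence of `p` because `k < n`. -/
theorem exists_nsmul_of_nsmul_eq_zero [Fact p.Prime] {k n : ℕ} (hk : k < n)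
    (x : ZMod (p ^ (n + 1))) (hx : p ^ (k + 1) • x = 0) :
    ∃ z, p ^ (k + 1) • z = p ^ k • x := by
  have hp := (Fact.out : p.Prime).ne_zero
  have hp' : NeZero p := ⟨hp⟩
  obtain ⟨a, rfl⟩ := ZMod.natCast_zmod_surjective x
  rw [_root_.nsmul_eq_mul, ← Nat.cast_mul, ZMod.natCast_eq_zero_iff,
    show n + 1 = (k + 1) + (n - k) by omega, pow_add] at hx
  obtain ⟨c, rfl⟩ := (dvd_pow_self p (by omega)).trans
    (Nat.dvd_of_mul_dvd_mul_left (pow_pos (Nat.pos_of_ne_zero hp) _) hx)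
  exact ⟨c, by simp only [_root_.nsmul_eq_mul]; push_cast; ring⟩

/-- `P_k / P_{k+1}` is an `F_p`-space with one dimension for each summand of order `p^(k+1)`, so it
has `p^m` elements iff there are `m` such summands. With fewer summands, the pigeonhole principle
gives two members of the family with the same residues modulo `p` on them. Conversely, the `p^m`
combinations with digits below `p` are separated. -/
theorem hasSeparatedFamily_cyclicSum_iff [hp : Fact p.Prime] (h : ι → ℕ) (k m : ℕ) :
    HasSeparatedFamily p (CyclicSum p h) k (p ^ m) ↔ Nonempty (Fin m ↪ {i // h i = k}) := by
  classical
  have hp0 := hp.out.ne_zero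
  have hp' : NeZero p := ⟨hp0⟩
  constructor
  · rintro ⟨y, hy, hsep⟩
    by_contra hne
    have hfin : Finite {i // h i = k} := by
      by_contra hinf
      rw [not_finite_iff_infinite] at hinf
      exact hne ⟨(Fin.valEmbedding).trans (Infinite.natEmbedding _)⟩
    have := Fintype.ofFinite {i // h i = k}
    have hcard : Fintype.card {i // h i = k} < m := by
      by_contra! hle
      exact hne (Function.Embedding.nonempty_of_card_le (by simpa using hle))
    let φ : Fin (p ^ m) → ({i // h i = k} → ZMod p) := fun j i => ((y j i.1).val : ZMod p)
    obtain ⟨j, j', hjj, hφ⟩ := Fintype.exists_ne_map_eq_of_card_lt φ (by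
      simpa [ZMod.card] using Nat.pow_lt_pow_right hp.out.one_lt hcard)
    -- Coordinatewise: summands of smaller order are killed by `p^k`, on those of order `p^(k+1)`
    -- the collision makes the difference vanish, and on larger ones torsion forces divisibility.
    obtain ⟨z, hz⟩ := CyclicSum.exists_nsmul_eq (p ^ (k + 1)) (x := p ^ k • (y j - y j')) (by
      intro i
      have hyi : ∀ j, p ^ (k + 1) • y j i = 0 := fun j => DFinsupp.ext_iff.1 (hy j) i
      rcases lt_trichotomy (h i) k with hik | hik | hik
      · exact ⟨0, by
          rw [smul_zero]
          exact (pow_nsmul_zmod_eq_zero hik ((y j - y j') i)).symm⟩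
      · refine ⟨0, ?_⟩
        have h1 := congrFun hφ ⟨i, hik⟩
        simp only [φ, ZMod.natCast_eq_natCast_iff] at h1
        have h2 : p ^ k • y j i = p ^ k • y j' i := by
          rw [← ZMod.natCast_rightInverse (y j i), ← ZMod.natCast_rightInverse (y j' i)]
          simp only [_root_.nsmul_eq_mul, ← Nat.cast_mul]
          rw [ZMod.natCast_eq_natCast_iff]
          exact (h1.mul_left' (p ^ k)).of_dvd (dvd_of_eq (by rw [hik, pow_succ]))
        rw [smul_zero]
        change 0 = p ^ k • (y j i - y j' i)
        rw [smul_sub, h2, _root_.sub_self]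
      · refine exists_nsmul_of_nsmul_eq_zero hik _ ?_
        change p ^ (k + 1) • (y j i - y j' i) = 0
        rw [smul_sub, hyi, hyi, _root_.sub_self])
    refine hsep j j' hjj z ?_
    rw [hz, smul_sub]
    abel
  · rintro ⟨g⟩
    let y : (Fin m → Fin p) → CyclicSum p h := fun a =>
      ∑ t, DirectSum.of (fun i => ZMod (p ^ (h i + 1))) (g t).1 ((a t : ℕ) : ZMod _)
    have hyt : ∀ a t, y a (g t).1 = ((a t : ℕ) : ZMod _) := by
      intro a t
      rw [DFinsupp.finsetSum_apply, Finset.sum_eq_single t]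
      · exact DirectSum.of_eq_same _ _
      · intro s _ hst
        exact DirectSum.of_eq_of_ne _ _ _ fun h => hst (g.injective (Subtype.ext h)).symm
      · simp
    have hcard : Fintype.card (Fin m → Fin p) = p ^ m := by simp
    let e := (Fintype.equivFinOfCardEq hcard).symm
    refine ⟨fun j => y (e j), fun j => ?_, fun j j' hjj z hz => ?_⟩
    · simp only [y, Finset.smul_sum]
      refine Finset.sum_eq_zero fun t _ => ?_
      rw [← map_nsmul, pow_nsmul_zmod_eq_zero (by rw [(g t).2]), map_zero]
    · refine hjj (e.injective (funext fun t => Fin.ext ?_))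
      have h1 := DFinsupp.ext_iff.1 hz (g t).1
      have h2 : p ^ k • y (e j) (g t).1 = p ^ k • y (e j') (g t).1 := by
        have h3 : p ^ (k + 1) • z (g t).1 = 0 :=
          pow_nsmul_zmod_eq_zero (by rw [(g t).2]) _
        exact h1.trans ((congrArg (p ^ k • y (e j') (g t).1 + ·) h3).trans (add_zero _))
      rw [hyt, hyt] at h2
      generalize (g t).1 = i, (g t).2 = hi at h2
      subst hi
      have := natCast_mul_pow_zmod_eq hp0 h2
      exact (Nat.mod_eq_of_lt (e j t).2) ▸ (Nat.mod_eq_of_lt (e j' t).2) ▸ this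

/-- The guard is needed because `Nat.card` is `0` on infinite types. -/
theorem nonempty_fin_embedding_iff {γ : Type*} (n : ℕ) :
    Nonempty (Fin n ↪ γ) ↔ (Finite γ → n ≤ Nat.card γ) := by
  rcases finite_or_infinite γ with hγ | hγ
  · have := Fintype.ofFinite γ
    rw [Nat.card_eq_fintype_card, Function.Embedding.nonempty_iff_card_le, Fintype.card_fin]
    exact ⟨fun h _ => h, fun h => h hγ⟩
  · exact ⟨fun _ h => absurd h (not_finite_iff_infinite.2 hγ),
      fun _ => ⟨Fin.valEmbedding.trans (Infinite.natEmbedding _)⟩⟩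

theorem nonempty_equiv_of_fin_embedding_iff {α β : Type*} [Countable α] [Countable β]
    (h : ∀ m, Nonempty (Fin m ↪ α) ↔ Nonempty (Fin m ↪ β)) : Nonempty (α ≃ β) := by
  simp only [nonempty_fin_embedding_iff] at h
  rcases finite_or_infinite α with hα | hα <;> rcases finite_or_infinite β with hβ | hβ
  · simp only [hα, hβ, forall_const] at h
    exact (Finite.card_eq).1 (le_antisymm ((h _).1 le_rfl) ((h _).2 le_rfl))
  · exact absurd ((h (Nat.card α + 1)).2 (fun h => (not_finite β).elim) hα) (by omega)
  · exact absurd ((h (Nat.card β + 1)).1 (fun h => (not_finite α).elim) hβ) (by omega)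
  · obtain ⟨_⟩ := nonempty_denumerable α
    obtain ⟨_⟩ := nonempty_denumerable β
    exact ⟨Denumerable.equiv₂ α β⟩

theorem cyclicSum_equiv_of_fibers {h : ι → ℕ} {h' : κ → ℕ}
    (H : ∀ k, Nonempty ({i // h i = k} ≃ {j // h' j = k})) :
    Nonempty (CyclicSum p h ≃+ CyclicSum p h') := by
  let σ : ι ≃ κ := (Equiv.sigmaFiberEquiv h).symm.trans
    ((Equiv.sigmaCongrRight fun k => (H k).some).trans (Equiv.sigmaFiberEquiv h'))
  have hσ : h = h' ∘ σ := funext fun i => ((H (h i)).some ⟨i, rfl⟩).2.symm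
  rw [hσ]
  exact ⟨(DirectSum.equivCongrLeft (β := fun j => ZMod (p ^ (h' j + 1))) σ.symm).symm⟩

end CyclicSums

/-! ### Prüfer's theorem and the classification -/

section Classification

variable {p : ℕ} {G : Type*} [AddCommGroup G]

/-- The socle, filtered by height, has an adapted basis `b`. With `p ^ h i • y i = b i`, the
elements `y i` generate cyclic groups of order `p ^ (h i + 1)` whose sum is direct and exhausts `G`.
-/
theorem exists_cyclicSum_equiv [hp : Fact p.Prime] [Countable G] (hG : IsAbelianPGroup p G)
    (hs : IsPSeparated p G) :
    ∃ (I : Set ℕ) (h : I → ℕ), Nonempty (CyclicSum p h ≃+ G) := by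
  classical
  have hp0 := hp.out.ne_zero
  have hp' : NeZero p := ⟨hp0⟩
  let S := (nsmulAddMonoidHom (α := G) p).ker
  have hS : ∀ x : S, p • x = 0 := fun x => Subtype.ext x.2
  obtain ⟨_⟩ : Nonempty (Module (ZMod p) S) := ⟨AddCommGroup.zmodModule hS⟩
  let P : ℕ → Submodule (ZMod p) S := fun k => AddSubgroup.toZModSubmodule p
    ((nsmulAddMonoidHom (α := G) (p ^ k)).range.comap S.subtype)
  have hP : ∀ {k : ℕ} {x : S}, x ∈ P k ↔ ∃ y : G, p ^ k • y = x := by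
    intro k x; exact AddSubgroup.mem_toZModSubmodule p
  obtain ⟨I, b, h, hb⟩ := exists_filtered_basis P (fun k l hkl x hx => by
      obtain ⟨y, hy⟩ := hP.1 hx
      exact hP.2 ⟨p ^ (l - k) • y, by rw [← hy, ← mul_smul, ← pow_add, Nat.add_sub_cancel' hkl]⟩)
    (Submodule.eq_top_iff'.2 fun x => hP.2 ⟨x, by simp⟩)
    (fun x hx => Subtype.ext (hs x fun k => hP.1 (hx k)))
  have hbP : ∀ i, b i ∈ P (h i) := fun i => (hb _ _).2 fun j hj => by
    rw [b.repr_self, Finsupp.single_apply_ne_zero] at hj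
    rw [hj.1]
  choose y hy using fun i => hP.1 (hbP i)
  have hy0 : ∀ i, p ^ (h i + 1) • y i = 0 := fun i => by
    rw [pow_succ', mul_smul, hy]
    exact (b i).2
  let φ : ∀ i, ZMod (p ^ (h i + 1)) →+ G := fun i =>
    ZMod.lift _ ⟨zmultiplesHom G (y i), by
      rw [zmultiplesHom_apply, natCast_zsmul, hy0]⟩
  have hφ : ∀ i (n : ℕ), φ i n = n • y i := fun i n => by
    rw [← natCast_zsmul, ← Int.cast_natCast (R := ZMod _)]
    exact ZMod.lift_coe _ _ _
  let Φ : CyclicSum p h →+ G := DirectSum.toAddMonoid φ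
  have hΦ : ∀ i (n : ℕ), n • y i ∈ Φ.range := fun i n =>
    ⟨DirectSum.of _ i (n : ZMod _), by rw [DirectSum.toAddMonoid_of, hφ]⟩
  have hsurj : ∀ m (x : G), p ^ m • x = 0 → x ∈ Φ.range := by
    intro m
    induction m with
    | zero =>
      intro x hx
      rw [pow_zero, one_smul] at hx
      exact hx ▸ zero_mem _
    | succ m ih =>
      intro x hx
      let s : S := ⟨p ^ m • x, show p • p ^ m • x = 0 by rw [← mul_smul, ← pow_succ', hx]⟩
      have hsP : s ∈ P m := hP.2 ⟨x, rfl⟩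
      -- Every `b i` occurring in `p ^ m • x` has `m ≤ h i`, so it is `p ^ m` times a multiple of `y
      -- i`. Hence `p ^ m • x = p ^ m • w` with `w` in the range, and induction applies to `x - w`.
      have : s ∈ (Φ.range.map (nsmulAddMonoidHom (p ^ m))).comap S.subtype := by
        rw [← b.linearCombination_repr s, Finsupp.linearCombination_apply]
        refine AddSubgroup.sum_mem _ fun i hi => ?_
        have hmi := (hb _ _).1 hsP i (Finsupp.mem_support_iff.1 hi)
        refine ⟨_, hΦ i ((b.repr s i).val * p ^ (h i - m)), ?_⟩
        have h1 : b.repr s i • b i = (b.repr s i).val • b i := by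
          rw [← Nat.cast_smul_eq_nsmul (ZMod p), ZMod.natCast_zmod_val]
        dsimp only
        rw [h1, AddSubgroup.coe_subtype, AddSubgroup.coe_nsmul, ← hy, nsmulAddMonoidHom_apply,
          ← mul_smul, ← mul_smul, mul_left_comm, ← pow_add, Nat.add_sub_cancel' hmi]
      obtain ⟨w, hw, hwx⟩ := this
      have := ih (x - w) (by rw [smul_sub, sub_eq_zero]; exact hwx.symm)
      exact sub_add_cancel x w ▸ Φ.range.add_mem this hw
  -- On the socle, the coordinates are `c i * p ^ h i` and `Φ a` is the combination of the `b i`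
  -- with coefficients `c i`, so linear independence applies. A nonzero kernel would meet the socle,
  -- so this case suffices.
  have hinj1 : ∀ a : CyclicSum p h, p • a = 0 → Φ a = 0 → a = 0 := by
    intro a ha hΦa
    have hc : ∀ i, ∃ c : ℕ, a i = ((c * p ^ h i : ℕ) : ZMod (p ^ (h i + 1))) := by
      intro i
      have h1 : p • a i = 0 := DFinsupp.ext_iff.1 ha i
      rw [← ZMod.natCast_zmod_val (a i), _root_.nsmul_eq_mul, ← Nat.cast_mul,
        ZMod.natCast_eq_zero_iff] at h1
      obtain ⟨c, hc⟩ := Nat.dvd_of_mul_dvd_mul_left hp.out.pos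
        ((pow_succ' p (h i)).symm.dvd.trans h1)
      exact ⟨c, by rw [mul_comm, ← hc, ZMod.natCast_zmod_val]⟩
    choose c hc using hc
    have hc0 : ∀ i, a i = 0 ↔ (c i : ZMod p) = 0 := fun i => by
      rw [hc, ZMod.natCast_eq_zero_iff, ZMod.natCast_eq_zero_iff, pow_succ']
      exact Nat.mul_dvd_mul_iff_right (pow_pos hp.out.pos _)
    have hca : ∀ i, (c i : ZMod p) ≠ 0 → i ∈ a.support := fun i hi =>
      DFinsupp.mem_support_iff.2 (mt (hc0 i).1 hi)
    let C : I →₀ ZMod p := Finsupp.onFinset a.support (fun i => (c i : ZMod p)) hca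
    have hC : Finsupp.linearCombination (ZMod p) b C = 0 := by
      refine Subtype.ext ?_
      rw [Finsupp.linearCombination_apply,
        Finsupp.onFinset_sum hca (g := fun i r => r • b i) fun i => zero_smul _ _,
        AddSubgroup.coe_zero, ← hΦa, AddSubgroup.val_finsetSum]
      refine Eq.trans ?_ (DFinsupp.sumAddHom_apply φ a).symm
      refine Finset.sum_congr rfl fun i _ => ?_
      rw [hc i, Nat.cast_smul_eq_nsmul, AddSubgroup.coe_nsmul, ← hy, ← mul_smul]
      exact (hφ _ _).symm
    have hC0 := linearIndependent_iff.1 b.linearIndependent C hC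
    exact DFinsupp.ext fun i => (hc0 i).2 (DFunLike.congr_fun hC0 i)
  have hinj : ∀ m (a : CyclicSum p h), p ^ m • a = 0 → Φ a = 0 → a = 0 := by
    intro m
    induction m with
    | zero => intro a ha _; simpa using ha
    | succ m ih =>
      intro a ha hΦa
      refine ih a (hinj1 _ ?_ ?_) hΦa
      · rw [← mul_smul, ← pow_succ', ha]
      · rw [map_nsmul, hΦa, smul_zero]
  refine ⟨I, h, ⟨AddEquiv.ofBijective Φ ⟨(injective_iff_map_eq_zero Φ).2 fun a ha => ?_,
    fun x => ?_⟩⟩⟩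
  · obtain ⟨m, hm⟩ := isAbelianPGroup_cyclicSum (p := p) h a
    exact hinj m a hm ha
  · obtain ⟨m, hm⟩ := hG x
    exact hsurj m x hm

/-- Countable Abelian `p`-groups without elements of infinite height are classified by the numbers
of elements of `P_k` that are distinct modulo `P_{k+1}`. -/
theorem nonempty_addEquiv_iff [Fact p.Prime] {H : Type*} [AddCommGroup H] [Countable G]
    [Countable H] (hG : IsAbelianPGroup p G) (hGs : IsPSeparated p G) (hH : IsAbelianPGroup p H)
    (hHs : IsPSeparated p H) :
    Nonempty (G ≃+ H) ↔ ∀ k N, HasSeparatedFamily p G k N ↔ HasSeparatedFamily p H k N := by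
  refine ⟨fun ⟨e⟩ k N => hasSeparatedFamily_congr e, fun hGH => ?_⟩
  obtain ⟨I, h, ⟨e⟩⟩ := exists_cyclicSum_equiv hG hGs
  obtain ⟨J, h', ⟨e'⟩⟩ := exists_cyclicSum_equiv hH hHs
  obtain ⟨f⟩ := cyclicSum_equiv_of_fibers (p := p) (h := h) (h' := h') fun k =>
    nonempty_equiv_of_fin_embedding_iff fun m => by
      rw [← hasSeparatedFamily_cyclicSum_iff (p := p), ← hasSeparatedFamily_cyclicSum_iff (p := p),
        hasSeparatedFamily_congr e, hasSeparatedFamily_congr e', hGH]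
  exact ⟨e.symm.trans (f.trans e')⟩

theorem cyclicSum_equiv_iff [Fact p.Prime] {ι κ : Type*} [Countable ι] [Countable κ]
    (h : ι → ℕ) (h' : κ → ℕ) : Nonempty (CyclicSum p h ≃+ CyclicSum p h') ↔
      ∀ k, Nonempty ({i // h i = k} ≃ {j // h' j = k}) := by
  refine ⟨fun ⟨e⟩ k => nonempty_equiv_of_fin_embedding_iff fun m => ?_,
    cyclicSum_equiv_of_fibers⟩
  rw [← hasSeparatedFamily_cyclicSum_iff (p := p), ← hasSeparatedFamily_cyclicSum_iff (p := p),
    hasSeparatedFamily_congr e]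

end Classification

/-! ### Ulm invariants of `G^ω` -/

section UlmInvariants

universe u

variable {p : ℕ} {G : Type u} [AddCommGroup G]

theorem HasSeparatedFamily.nonempty_embedding {k N : ℕ} (h : HasSeparatedFamily p G k N) :
    Nonempty (Fin N ↪ UlmQuotient p G k) := by
  obtain ⟨y, hy, hsep⟩ := h
  have hmem : ∀ i, p ^ k • y i ∈ socleSeq p G k := fun i =>
    ⟨show p • p ^ k • y i = 0 by rw [← mul_smul, ← pow_succ', hy],
      (mem_subgroupSeq_natCast k).2 ⟨_, rfl⟩⟩
  refine ⟨⟨fun i => QuotientAddGroup.mk ⟨_, hmem i⟩, fun i j hij => ?_⟩⟩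
  by_contra hne
  rw [QuotientAddGroup.eq, AddSubgroup.mem_addSubgroupOf] at hij
  have h1 := hij.2
  rw [← Nat.cast_succ] at h1
  obtain ⟨z, hz⟩ := (mem_subgroupSeq_natCast (k + 1)).1 h1
  refine hsep j i (Ne.symm hne) z ?_
  rw [hz]
  simp

/-- A finite quotient with `m` elements could not contain `p ^ m > m` distinct ones; and an infinite
space over a finite field has infinite dimension. -/
theorem ulmInvariant_eq_aleph0 [Fact p.Prime] [Countable G] {k : ℕ}
    (h : ∀ m, HasSeparatedFamily p G k (p ^ m)) : ulmInvariant p G k = Cardinal.aleph0 := by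
  have hinf : Infinite (UlmQuotient p G k) := by
    by_contra hfin
    rw [not_infinite_iff_finite] at hfin
    obtain ⟨e⟩ := (h (Nat.card (UlmQuotient p G k))).nonempty_embedding
    have := Nat.card_le_card_of_injective e e.injective
    rw [Nat.card_fin] at this
    exact absurd this (not_le.2 (Nat.lt_pow_self (Fact.out : p.Prime).one_lt))
  have hcount : Countable (UlmQuotient p G k) :=
    (QuotientAddGroup.mk_surjective).countable
  have : NeZero p := ⟨(Fact.out : p.Prime).ne_zero⟩
  unfold ulmInvariant
  generalize AddCommGroup.zmodModule (nsmul_ulmQuotient p G k) = inst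
  refine le_antisymm ((rank_le_card _ _).trans (Cardinal.mk_le_aleph0_iff.2 hcount)) ?_
  by_contra! hlt
  have := Module.rank_lt_aleph0_iff.1 hlt
  have := Module.finite_of_finite (ZMod p) (M := UlmQuotient p G k)
  exact not_finite (UlmQuotient p G k)

theorem ulmInvariant_eq_zero [Fact p.Prime] (hG : IsPSeparated p G) {β : Ordinal.{u}}
    (hβ : ω ≤ β) : ulmInvariant p G β = 0 := by
  have hbot : subgroupSeq p G β = ⊥ :=
    le_bot_iff.1 ((subgroupSeq_antitone p G hβ).trans (isPSeparated_iff.1 hG).le)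
  have : Subsingleton (UlmQuotient p G β) := by
    have : Subsingleton (socleSeq p G β) := by
      rw [socleSeq, hbot, inf_bot_eq]
      infer_instance
    exact (QuotientAddGroup.mk_surjective).subsingleton
  unfold ulmInvariant
  generalize AddCommGroup.zmodModule (nsmul_ulmQuotient p G β) = inst
  exact rank_subsingleton' _ _

theorem hasSeparatedFamily_gOmega [Fact p.Prime] (k m : ℕ) :
    HasSeparatedFamily p (GOmega p) k (p ^ m) := by
  refine (hasSeparatedFamily_cyclicSum_iff (Prod.fst : ℕ × ℕ → ℕ) k m).2
    ⟨⟨fun i => ⟨(k, i), rfl⟩, fun i j h => ?_⟩⟩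
  simpa [Fin.ext_iff] using h

theorem countable_cyclicSum [Fact p.Prime] {ι : Type*} [Countable ι] (h : ι → ℕ) :
    Countable (CyclicSum p h) := by
  have : NeZero p := ⟨(Fact.out : p.Prime).ne_zero⟩
  classical
  exact inferInstanceAs (Countable (Π₀ i, ZMod (p ^ (h i + 1))))

end UlmInvariants

/-! ### Closure properties of relative computability -/

section RelativeComputability

open Encodable

variable {α β γ σ : Type*} [Primcodable α] [Primcodable β] [Primcodable γ] [Primcodable σ]
  {O : Set (ℕ →. ℕ)}

theorem computableIn_comp {f : β → σ} {g : α → β} (hf : ComputableIn O f)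
    (hg : ComputableIn O g) : ComputableIn O fun a => f (g a) :=
  (Nat.RecursiveIn.comp hf hg).of_eq fun n => by
    cases decode (α := α) n <;> simp [encodek]

theorem computableIn_pair {f : α → β} {g : α → γ} (hf : ComputableIn O f)
    (hg : ComputableIn O g) : ComputableIn O fun a => (f a, g a) :=
  (Nat.RecursiveIn.pair hf hg).of_eq fun n => by
    cases decode (α := α) n <;> simp [Seq.seq]

theorem computableIn_comp₂ {h : β → γ → σ} {f : α → β} {g : α → γ} (hh : Primrec₂ h)
    (hf : ComputableIn O f) (hg : ComputableIn O g) : ComputableIn O fun a => h (f a) (g a) :=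
  computableIn_comp (Primrec.computableIn hh) (computableIn_pair hf hg)

theorem computableIn_nat_rec {f : α → σ} {g : α × ℕ × σ → σ} (hf : ComputableIn O f)
    (hg : ComputableIn O g) :
    ComputableIn O fun q : α × ℕ =>
      (Nat.rec (f q.1) (fun y ih => g (q.1, y, ih)) q.2 : σ) :=
  (Nat.RecursiveIn.prec hf hg).of_eq fun n => by
    cases e : decode (α := α) n.unpair.1 with
    -- A parameter that does not decode makes both sides undefined, at every stage of the recursion.
    | none =>
      simp only [e, Encodable.decode_prod_val, Nat.unpair_pair, Part.coe_none, Part.bind_none,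
        Option.bind_none]
      induction n.unpair.2 with
      | zero => rfl
      | succ k ih =>
        dsimp only at ih ⊢
        rw [ih]
        exact Part.bind_none _
    | some a =>
      simp only [e, Encodable.decode_prod_val, Nat.unpair_pair, Part.coe_some, Part.bind_some,
        Option.bind_some, Part.map_some, Encodable.decode_nat, Option.map_some]
      induction n.unpair.2 with
      | zero => rfl
      | succ k ih =>
        dsimp only at ih ⊢
        rw [ih]
        simp [encodek]

end RelativeComputability

section RelativePredicates

variable {α β : Type} [Primcodable α] [Primcodable β] {X : Set ℕ}

theorem computablePredIn_iff {P : α → Prop} :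
    ComputablePredIn X P ↔ ∃ f : α → Bool, ComputableIn {oracle X} f ∧ ∀ a, P a ↔ f a = true := by
  classical
  constructor
  · intro h
    refine ⟨_, h, fun a => ?_⟩
    simp
  · rintro ⟨f, hf, hP⟩
    have : (fun a => decide (P a)) = f := funext fun a => by
      rw [Bool.eq_iff_iff, decide_eq_true_iff, hP]
    rw [← this] at hf
    unfold ComputablePredIn
    convert hf

theorem _root_.PrimrecPred.computablePredIn {P : α → Prop} (h : PrimrecPred P) :
    ComputablePredIn X P := by
  obtain ⟨_, h⟩ := h
  exact computablePredIn_iff.2 ⟨_, h.computableIn, fun a => by simp⟩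

theorem _root_.ComputablePred.computablePredIn {P : α → Prop} (h : ComputablePred P) :
    ComputablePredIn X P := by
  obtain ⟨_, h⟩ := h
  exact computablePredIn_iff.2 ⟨_, h.computableIn, fun a => by simp⟩

/-- The oracle of the empty set is the constant function `0`, which can be eliminated. -/
theorem ComputablePredIn.computablePred {P : α → Prop} (h : ComputablePredIn ∅ P) :
    ComputablePred P := by
  obtain ⟨f, hf, hP⟩ := computablePredIn_iff.1 h
  have hf' : Computable f := RecursiveIn.partrec_of_const (s := Part.some 0) <| by
    have : oracle ∅ = fun _ => Part.some 0 := by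
      funext n
      simp [oracle]
    rwa [this] at hf
  exact ⟨fun a => Classical.dec _, hf'.of_eq fun a => by
    exact (Bool.eq_iff_iff.2 ((@decide_eq_true_iff _ (Classical.dec _)).trans (hP a))).symm⟩

theorem ComputablePredIn.comp {P : β → Prop} (h : ComputablePredIn X P) {f : α → β}
    (hf : ComputableIn {oracle X} f) : ComputablePredIn X fun a => P (f a) := by
  obtain ⟨g, hg, hP⟩ := computablePredIn_iff.1 h
  exact computablePredIn_iff.2 ⟨_, computableIn_comp hg hf, fun a => hP _⟩

theorem ComputablePredIn.of_eq {P Q : α → Prop} (h : ComputablePredIn X P)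
    (H : ∀ a, P a ↔ Q a) : ComputablePredIn X Q :=
  (funext fun a => propext (H a) : P = Q) ▸ h

theorem ComputablePredIn.not {P : α → Prop} (h : ComputablePredIn X P) :
    ComputablePredIn X fun a => ¬P a := by
  obtain ⟨g, hg, hP⟩ := computablePredIn_iff.1 h
  exact computablePredIn_iff.2
    ⟨_, computableIn_comp (Primrec.computableIn Primrec.not) hg, fun a => by simp [hP]⟩

theorem ComputablePredIn.and {P Q : α → Prop} (h : ComputablePredIn X P)
    (h' : ComputablePredIn X Q) : ComputablePredIn X fun a => P a ∧ Q a := by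
  obtain ⟨g, hg, hP⟩ := computablePredIn_iff.1 h
  obtain ⟨g', hg', hQ⟩ := computablePredIn_iff.1 h'
  exact computablePredIn_iff.2
    ⟨_, computableIn_comp₂ Primrec.and hg hg', fun a => by simp [hP, hQ]⟩

theorem ComputablePredIn.or {P Q : α → Prop} (h : ComputablePredIn X P)
    (h' : ComputablePredIn X Q) : ComputablePredIn X fun a => P a ∨ Q a := by
  obtain ⟨g, hg, hP⟩ := computablePredIn_iff.1 h
  obtain ⟨g', hg', hQ⟩ := computablePredIn_iff.1 h'
  exact computablePredIn_iff.2
    ⟨_, computableIn_comp₂ Primrec.or hg hg', fun a => by simp [hP, hQ]⟩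

theorem ComputablePredIn.forall_lt {P : α × ℕ → Prop} (h : ComputablePredIn X P) :
    ComputablePredIn X fun q : α × ℕ => ∀ i < q.2, P (q.1, i) := by
  obtain ⟨g, hg, hP⟩ := computablePredIn_iff.1 h
  have hstep : ComputableIn {oracle X} fun q : α × ℕ × Bool => (q.2.2 && g (q.1, q.2.1)) :=
    computableIn_comp₂ Primrec.and
      (Primrec.computableIn (Primrec.snd.comp Primrec.snd))
      (computableIn_comp hg
        (Primrec.computableIn (Primrec.pair Primrec.fst (Primrec.fst.comp Primrec.snd))))
  refine computablePredIn_iff.2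
    ⟨_, computableIn_nat_rec (ComputableIn.const true) hstep, fun ⟨a, n⟩ => ?_⟩
  dsimp only
  induction n with
  | zero => simp
  | succ n ih =>
    rw [Nat.forall_lt_succ_right, Bool.and_eq_true, ← hP, ← ih]

theorem ComputablePredIn.exists_lt {P : α × ℕ → Prop} (h : ComputablePredIn X P) :
    ComputablePredIn X fun q : α × ℕ => ∃ i < q.2, P (q.1, i) :=
  h.not.forall_lt.not.of_eq fun q => by push Not; rfl

end RelativePredicates

/-! ### Searching for a witness of an `∃∀` condition -/

section WitnessSearch

/-- The search for `y` with `∀ z, r y z`: the state consists of the current `y` and of the next `z`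
to be tested. -/
def searchState (r : ℕ → ℕ → Bool) (s : ℕ) : ℕ × ℕ :=
  Nat.rec (0, 0) (fun _ q => bif r q.1 q.2 then (q.1, q.2 + 1) else (q.1 + 1, 0)) s

variable (r : ℕ → ℕ → Bool)

/-- The candidate is rejected at stage `s`. -/
def SearchRejects (s : ℕ) : Prop := r (searchState r s).1 (searchState r s).2 = false

variable {r}

theorem searchState_succ_of_rejects {s : ℕ} (h : SearchRejects r s) :
    searchState r (s + 1) = ((searchState r s).1 + 1, 0) := by
  rw [SearchRejects] at h
  change (bif r (searchState r s).1 (searchState r s).2 then _ else _) = _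
  rw [h, cond_false]
  rfl

theorem searchState_succ_of_not_rejects {s : ℕ} (h : ¬SearchRejects r s) :
    searchState r (s + 1) = ((searchState r s).1, (searchState r s).2 + 1) := by
  rw [SearchRejects, Bool.not_eq_false] at h
  change (bif r (searchState r s).1 (searchState r s).2 then _ else _) = _
  rw [h, cond_true]
  rfl

theorem searchState_tested (s : ℕ) : ∀ z < (searchState r s).2, r (searchState r s).1 z = true := by
  induction s with
  | zero => intro z hz; exact absurd hz (Nat.not_lt_zero z)
  | succ s ih =>
    by_cases h : SearchRejects r s
    · rw [searchState_succ_of_rejects h]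
      intro z hz
      exact absurd hz (Nat.not_lt_zero z)
    · rw [searchState_succ_of_not_rejects h]
      intro z hz
      rcases Nat.lt_succ_iff_lt_or_eq.1 hz with hz | rfl
      · exact ih z hz
      · rwa [SearchRejects, Bool.not_eq_false] at h

theorem monotone_searchState_fst : Monotone fun s => (searchState r s).1 :=
  monotone_nat_of_le_succ fun s => by
    by_cases h : SearchRejects r s
    · rw [searchState_succ_of_rejects h]
      exact Nat.le_succ _
    · rw [searchState_succ_of_not_rejects h]

/-- The search never passes a true witness, so it can reject only finitely often. Conversely, after
the last rejection the candidate is fixed and gets tested against every `z`. -/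
theorem exists_forall_iff_eventually_not_rejects :
    (∃ y, ∀ z, r y z = true) ↔ ∃ s₀, ∀ s, s₀ ≤ s → ¬SearchRejects r s := by
  constructor
  · rintro ⟨y, hy⟩
    by_contra! hc
    have hle : ∀ s, (searchState r s).1 ≤ y := by
      intro s
      induction s with
      | zero => exact Nat.zero_le y
      | succ s ih =>
        by_cases h : SearchRejects r s
        · rw [searchState_succ_of_rejects h]
          refine Nat.succ_le_of_lt (lt_of_le_of_ne ih fun he => ?_)
          rw [SearchRejects, he, hy] at h
          exact absurd h (by simp)
        · rwa [searchState_succ_of_not_rejects h]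
    have hge : ∀ N, ∃ s, N ≤ (searchState r s).1 := by
      intro N
      induction N with
      | zero => exact ⟨0, Nat.zero_le _⟩
      | succ N ih =>
        obtain ⟨s, hs⟩ := ih
        obtain ⟨t, hst, ht⟩ := hc s
        refine ⟨t + 1, ?_⟩
        rw [searchState_succ_of_rejects ht]
        exact Nat.succ_le_succ (hs.trans (monotone_searchState_fst hst))
    obtain ⟨s, hs⟩ := hge (y + 1)
    exact absurd (hle s) (by omega)
  · rintro ⟨s₀, h⟩
    have hst : ∀ t, searchState r (s₀ + t) = ((searchState r s₀).1, (searchState r s₀).2 + t) := by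
      intro t
      induction t with
      | zero => rfl
      | succ t ih =>
        rw [← Nat.add_assoc, searchState_succ_of_not_rejects (h _ (Nat.le_add_right _ _)), ih,
          Nat.add_assoc]
    refine ⟨(searchState r s₀).1, fun z => ?_⟩
    have := searchState_tested (r := r) (s₀ + (z + 1)) z
    rw [hst] at this
    exact this (by dsimp only; omega)

end WitnessSearch

/-! ### From `Π⁰₃` to infinitely many solutions of a `Π⁰₁` condition -/

section InfinitelyMany

variable (C : ℕ → ℕ → Prop)

/-- It is visible at stage `z` that `s` is not the first stage from which on no `C x` with `x < l`
changes. -/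
def NotLastChange (l s z : ℕ) : Prop :=
  ¬(s = 0 ∨ ∃ x < l, C x (s - 1)) ∨ (s ≤ z ∧ ∃ x < l, C x z)

variable {C}

/-- If `s < t`, minimality of `t` gives a change at stage `t - 1 ≥ s`, contrary to the choice of
`s`. -/
theorem lastChange_unique {l s t : ℕ} (hs : ∀ z, ¬NotLastChange C l s z)
    (ht : ∀ z, ¬NotLastChange C l t z) : s = t := by
  have key : ∀ {s t}, (∀ z, ¬NotLastChange C l s z) → (∀ z, ¬NotLastChange C l t z) → ¬s < t := by
    intro s t hs ht hst
    have h1 := ht 0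
    have h2 := hs (t - 1)
    rw [NotLastChange, not_or, not_not] at h1
    rw [NotLastChange, not_or, not_and] at h2
    exact h2.2 (by omega) (h1.1.resolve_left (by omega))
  have h1 := key hs ht
  have h2 := key ht hs
  omega

/-- By uniqueness, infinitely many `v` means infinitely many `l`. As the condition for `l` concerns
all `x < l`, arbitrarily large `l` cover every `x`. -/
theorem infinite_lastChange_iff :
    {v : ℕ | ∀ z, ¬NotLastChange C v.unpair.1 v.unpair.2 z}.Infinite ↔
      ∀ x, ∃ s₀, ∀ s, s₀ ≤ s → ¬C x s := by
  constructor
  · intro hinf x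
    by_contra! hc
    refine hinf (Set.Finite.of_finite_image (f := fun v => v.unpair.1)
      ((Set.finite_Iic x).subset ?_) ?_)
    · rintro _ ⟨v, hv, rfl⟩
      by_contra! hx
      obtain ⟨s, hs, hC⟩ := hc v.unpair.2
      exact hv s (Or.inr ⟨hs, x, not_le.1 hx, hC⟩)
    · intro v hv w hw h
      have hw' := hw
      dsimp only at h
      rw [Set.mem_ofPred_eq, ← h] at hw'
      rw [← Nat.pair_unpair v, ← Nat.pair_unpair w, h, lastChange_unique hv hw']
  · intro h
    have hbd : ∀ l, ∃ s₀, ∀ s, s₀ ≤ s → ¬∃ x < l, C x s := by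
      intro l
      induction l with
      | zero => exact ⟨0, by simp⟩
      | succ l ih =>
        obtain ⟨s₀, hs₀⟩ := ih
        obtain ⟨s₁, hs₁⟩ := h l
        refine ⟨max s₀ s₁, fun s hs => ?_⟩
        rintro ⟨x, hx, hC⟩
        rcases Nat.lt_succ_iff_lt_or_eq.1 hx with hx | rfl
        · exact hs₀ s (le_of_max_le_left hs) ⟨x, hx, hC⟩
        · exact hs₁ s (le_of_max_le_right hs) hC
    have hlast : ∀ l, ∃ s, ∀ z, ¬NotLastChange C l s z := by
      intro l
      classical
      -- The least bound is either `0` or directly preceded by a change.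
      refine ⟨Nat.find (hbd l), fun z => ?_⟩
      rintro (h1 | ⟨h1, h2⟩)
      · rw [not_or] at h1
        refine Nat.find_min (hbd l) (m := Nat.find (hbd l) - 1) (by omega) fun s hs => ?_
        rcases hs.eq_or_lt with rfl | hs
        · exact h1.2
        · exact Nat.find_spec (hbd l) s (by omega)
      · exact Nat.find_spec (hbd l) z h1 h2
    choose s hs using hlast
    refine Set.infinite_of_injective_forall_mem (f := fun l => Nat.pair l (s l)) ?_ ?_
    · intro l m hlm
      exact (Nat.pair_eq_pair.1 hlm).1
    · intro l
      rw [Set.mem_ofPred_eq, Nat.unpair_pair]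
      exact hs l

/-- Every `Π⁰₃` set is the set of `n` such that a `Π⁰₁` relation holds of `n` and of infinitely
many `v`. -/
theorem IsPi03In.exists_infinite_iff {X S : Set ℕ} (h : IsPi03In X S) :
    ∃ Q : ℕ × ℕ × ℕ → Prop, ComputablePredIn X Q ∧
      ∀ n, n ∈ S ↔ {v | ∀ z, ¬Q (n, v, z)}.Infinite := by
  obtain ⟨R, hR, hS⟩ := h
  obtain ⟨r, hr, hRr⟩ := computablePredIn_iff.1 hR
  let C : ℕ → ℕ → ℕ → Prop := fun n x s => SearchRejects (fun y z => r (n, x, y, z)) s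
  have hstate : ComputableIn {oracle X} fun q : (ℕ × ℕ) × ℕ =>
      searchState (fun y z => r (q.1.1, q.1.2, y, z)) q.2 := by
    have hstep : ComputableIn {oracle X} fun q : (ℕ × ℕ) × ℕ × (ℕ × ℕ) =>
        bif r (q.1.1, q.1.2, q.2.2.1, q.2.2.2) then (q.2.2.1, q.2.2.2 + 1)
          else (q.2.2.1 + 1, 0) := by
      have h1 : ComputableIn {oracle X} fun q : (ℕ × ℕ) × ℕ × (ℕ × ℕ) =>
          r (q.1.1, q.1.2, q.2.2.1, q.2.2.2) :=
        computableIn_comp hr (Primrec.computableIn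
          (((Primrec.fst.comp Primrec.fst).pair ((Primrec.snd.comp Primrec.fst).pair
            (Primrec.snd.comp Primrec.snd)))))
      have h2 : Primrec₂ fun (b : Bool) (q : ℕ × ℕ) =>
          bif b then (q.1, q.2 + 1) else (q.1 + 1, 0) :=
        Primrec.cond Primrec.fst
          ((Primrec.fst.comp Primrec.snd).pair
            (Primrec.succ.comp (Primrec.snd.comp Primrec.snd)))
          ((Primrec.succ.comp (Primrec.fst.comp Primrec.snd)).pair (Primrec.const 0))
      exact computableIn_comp₂ h2 h1 (Primrec.computableIn (Primrec.snd.comp Primrec.snd))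
    exact computableIn_nat_rec (ComputableIn.const (0, 0)) hstep
  have hC : ComputablePredIn X fun q : (ℕ × ℕ) × ℕ => C q.1.1 q.1.2 q.2 := by
    refine ComputablePredIn.of_eq (P := fun q : (ℕ × ℕ) × ℕ => ¬R (q.1.1, q.1.2,
      searchState (fun y z => r (q.1.1, q.1.2, y, z)) q.2)) ?_ fun q => ?_
    · refine (hR.comp (computableIn_pair ?_ (computableIn_pair ?_ hstate))).not
      · exact Primrec.computableIn (Primrec.fst.comp Primrec.fst)
      · exact Primrec.computableIn (Primrec.snd.comp Primrec.fst)
    · rw [hRr, Bool.not_eq_true]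
      rfl
  have hex : ComputablePredIn X fun q : ℕ × ℕ × ℕ => ∃ x < q.2.1, C q.1 x q.2.2 := by
    have h1 : ComputablePredIn X fun q : (ℕ × ℕ) × ℕ => C q.1.1 q.2 q.1.2 :=
      hC.comp (f := fun q : (ℕ × ℕ) × ℕ => ((q.1.1, q.2), q.1.2)) (Primrec.computableIn
        (((Primrec.fst.comp Primrec.fst).pair Primrec.snd).pair (Primrec.snd.comp Primrec.fst)))
    exact h1.exists_lt.comp (f := fun q : ℕ × ℕ × ℕ => ((q.1, q.2.2), q.2.1))
      (Primrec.computableIn ((Primrec.fst.pair (Primrec.snd.comp Primrec.snd)).pair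
        (Primrec.fst.comp Primrec.snd)))
  refine ⟨fun q => NotLastChange (C q.1) q.2.1.unpair.1 q.2.1.unpair.2 q.2.2, ?_, fun n => ?_⟩
  · have hl : Primrec fun q : ℕ × ℕ × ℕ => q.2.1.unpair.1 :=
      Primrec.fst.comp (Primrec.unpair.comp (Primrec.fst.comp Primrec.snd))
    have hs : Primrec fun q : ℕ × ℕ × ℕ => q.2.1.unpair.2 :=
      Primrec.snd.comp (Primrec.unpair.comp (Primrec.fst.comp Primrec.snd))
    have hz : Primrec fun q : ℕ × ℕ × ℕ => q.2.2 := Primrec.snd.comp Primrec.snd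
    refine (ComputablePredIn.or ?_ ?_).not.or (ComputablePredIn.and ?_ ?_)
    · exact (Primrec.eq.comp hs (Primrec.const 0)).computablePredIn
    · exact hex.comp (f := fun q : ℕ × ℕ × ℕ => (q.1, q.2.1.unpair.1, q.2.1.unpair.2 - 1))
        (Primrec.computableIn (Primrec.fst.pair (hl.pair (Primrec.pred.comp hs))))
    · exact (Primrec.nat_le.comp hs hz).computablePredIn
    · exact hex.comp (f := fun q : ℕ × ℕ × ℕ => (q.1, q.2.1.unpair.1, q.2.2))
        (Primrec.computableIn (Primrec.fst.pair (hl.pair hz)))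
  · rw [hS]
    dsimp only
    rw [infinite_lastChange_iff]
    refine forall_congr' fun x => ?_
    rw [← exists_forall_iff_eventually_not_rejects]
    simp only [hRr]

end InfinitelyMany

/-! ### Primitive recursion along Gödel numbers -/

section CodeRecursion

/-- Tag `0` must be excluded: `Nat.pair 0 b = b * b` does not exceed `b` for `b ≤ 1`. -/
theorem unpair_snd_lt {q : ℕ} (h : q.unpair.1 ≠ 0) : q.unpair.2 < q := by
  conv_rhs => rw [← Nat.pair_unpair q]
  rw [Nat.pair]
  split_ifs
  · nlinarith [Nat.pos_of_ne_zero h, Nat.le_mul_self q.unpair.2]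
  · nlinarith [Nat.pos_of_ne_zero h]

variable {α σ : Type*}

/-- Recursion along Gödel numbers of closed terms. -/
def codeRec (f₀ f₁ : α → ℕ → σ) (f₂ : α → σ → σ) (f₃ : α → σ → σ → σ) (d : σ) (a : α) (q : ℕ) : σ :=
  if q.unpair.1 = 0 then f₀ a q.unpair.2
  else if q.unpair.1 = 1 then f₁ a q.unpair.2
  else if _h : q.unpair.1 = 2 then
    f₂ a (codeRec f₀ f₁ f₂ f₃ d a q.unpair.2)
  else if _h : q.unpair.1 = 3 then
    f₃ a (codeRec f₀ f₁ f₂ f₃ d a q.unpair.2.unpair.1)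
      (codeRec f₀ f₁ f₂ f₃ d a q.unpair.2.unpair.2)
  else d
termination_by q
decreasing_by
  · exact unpair_snd_lt (by omega)
  · exact (Nat.unpair_left_le _).trans_lt (unpair_snd_lt (by omega))
  · exact (Nat.unpair_right_le _).trans_lt (unpair_snd_lt (by omega))

variable (f₀ f₁ : α → ℕ → σ) (f₂ : α → σ → σ) (f₃ : α → σ → σ → σ) (d : σ) (a : α)

theorem codeRec_const (c : ℕ) : codeRec f₀ f₁ f₂ f₃ d a (Nat.pair 0 c) = f₀ a c := by
  rw [codeRec]; simp

theorem codeRec_zero (r : ℕ) : codeRec f₀ f₁ f₂ f₃ d a (Nat.pair 1 r) = f₁ a r := by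
  rw [codeRec]; simp

theorem codeRec_neg (r : ℕ) :
    codeRec f₀ f₁ f₂ f₃ d a (Nat.pair 2 r) = f₂ a (codeRec f₀ f₁ f₂ f₃ d a r) := by
  rw [codeRec]; simp

theorem codeRec_add (r s : ℕ) :
    codeRec f₀ f₁ f₂ f₃ d a (Nat.pair 3 (Nat.pair r s)) =
      f₃ a (codeRec f₀ f₁ f₂ f₃ d a r) (codeRec f₀ f₁ f₂ f₃ d a s) := by
  rw [codeRec]; simp

/-- Every number is the Gödel number of one of the four kinds of terms, or has an invalid tag. -/
theorem code_cases {P : ℕ → Prop} (const : ∀ c, P (Nat.pair 0 c)) (zero : ∀ r, P (Nat.pair 1 r))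
    (neg : ∀ r, P r → P (Nat.pair 2 r))
    (add : ∀ r s, P r → P s → P (Nat.pair 3 (Nat.pair r s)))
    (invalid : ∀ t r, 4 ≤ t → P (Nat.pair t r)) (q : ℕ) : P q := by
  induction q using Nat.strong_induction_on with
  | _ q ih =>
    have hlt := unpair_snd_lt (q := q)
    rw [← Nat.pair_unpair q]
    generalize q.unpair.1 = t at *
    generalize q.unpair.2 = r at *
    match t with
    | 0 => exact const r
    | 1 => exact zero r
    | 2 => exact neg r (ih r (hlt (by omega)))
    | 3 =>
      have hr := hlt (by omega)
      rw [← Nat.pair_unpair r]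
      exact add _ _ (ih _ ((Nat.unpair_left_le _).trans_lt hr))
        (ih _ ((Nat.unpair_right_le _).trans_lt hr))
    | t + 4 => exact invalid _ r (by omega)

theorem codeRec_invalid {t : ℕ} (ht : 4 ≤ t) (r : ℕ) :
    codeRec f₀ f₁ f₂ f₃ d a (Nat.pair t r) = d := by
  rw [codeRec]
  simp only [Nat.unpair_pair]
  rw [if_neg (by omega), if_neg (by omega), dif_neg (by omega), dif_neg (by omega)]

variable [Primcodable α] [Primcodable σ] {f₀ f₁ f₂ f₃ d}

/-- Course-of-values recursion: the list of earlier values has length `n`, so the argument `n`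
itself is recovered from it. -/
theorem primrec_codeRec (h₀ : Primrec₂ f₀) (h₁ : Primrec₂ f₁) (h₂ : Primrec₂ f₂)
    (h₃ : Primrec fun q : α × σ × σ => f₃ q.1 q.2.1 q.2.2) :
    Primrec₂ (codeRec f₀ f₁ f₂ f₃ d) := by
  have ht : Primrec fun q : α × List σ => q.2.length.unpair.1 :=
    Primrec.fst.comp (Primrec.unpair.comp (Primrec.list_length.comp Primrec.snd))
  have hr : Primrec fun q : α × List σ => q.2.length.unpair.2 :=
    Primrec.snd.comp (Primrec.unpair.comp (Primrec.list_length.comp Primrec.snd))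
  have hr1 : Primrec fun q : α × List σ => q.2.length.unpair.2.unpair.1 :=
    Primrec.fst.comp (Primrec.unpair.comp hr)
  have hr2 : Primrec fun q : α × List σ => q.2.length.unpair.2.unpair.2 :=
    Primrec.snd.comp (Primrec.unpair.comp hr)
  have heq : ∀ n, PrimrecPred fun q : α × List σ => q.2.length.unpair.1 = n := fun n =>
    Primrec.eq.comp ht (Primrec.const n)
  refine Primrec.nat_strong_rec _ (g := fun a L =>
    if L.length.unpair.1 = 0 then some (f₀ a L.length.unpair.2)
    else if L.length.unpair.1 = 1 then some (f₁ a L.length.unpair.2)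
    else if L.length.unpair.1 = 2 then L[L.length.unpair.2]?.map (f₂ a)
    else if L.length.unpair.1 = 3 then L[L.length.unpair.2.unpair.1]?.bind fun x =>
      L[L.length.unpair.2.unpair.2]?.map fun y => f₃ a x y
    else some d) ?_ fun a n => ?_
  · refine Primrec.ite (heq 0) (Primrec.option_some.comp (h₀.comp Primrec.fst hr)) <|
      Primrec.ite (heq 1) (Primrec.option_some.comp (h₁.comp Primrec.fst hr)) <|
      Primrec.ite (heq 2) (Primrec.option_map (Primrec.list_getElem?.comp Primrec.snd hr)
        (h₂.comp (Primrec.fst.comp Primrec.fst) Primrec.snd)) <|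
      Primrec.ite (heq 3) (Primrec.option_bind (Primrec.list_getElem?.comp Primrec.snd hr1)
        (Primrec.option_map (Primrec.list_getElem?.comp (Primrec.snd.comp Primrec.fst)
          (hr2.comp Primrec.fst)) ?_)) (Primrec.const _)
    exact h₃.comp ((Primrec.fst.comp (Primrec.fst.comp Primrec.fst)).pair
      ((Primrec.snd.comp Primrec.fst).pair Primrec.snd))
  · simp only [List.length_map, List.length_range]
    have hlt := unpair_snd_lt (q := n)
    have hL : ∀ m < n, ((List.range n).map (codeRec f₀ f₁ f₂ f₃ d a))[m]? =
        some (codeRec f₀ f₁ f₂ f₃ d a m) := fun m hm => by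
      simp [List.getElem?_range hm]
    rw [codeRec]
    split_ifs with h0 h1 h2 h3
    · rfl
    · rfl
    · rw [hL _ (hlt h0)]
      rfl
    · rw [hL _ ((Nat.unpair_left_le _).trans_lt (hlt h0)),
        hL _ ((Nat.unpair_right_le _).trans_lt (hlt h0))]
      rfl
    · rfl

end CodeRecursion

/-! ### Deciding diagrams from universes and term equality -/

section TermCodes

/-- The tags of the Gödel number are those of a closed term. -/
def isTermCode (q : ℕ) : Bool :=
  codeRec (fun (_ : Unit) _ => true) (fun _ r => decide (r = 0)) (fun _ x => x)
    (fun _ x y => x && y) false () q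

/-- The constant `c` occurs in the term with the Gödel number `q`. -/
def occursIn (c q : ℕ) : Bool :=
  codeRec (fun c r => decide (r = c)) (fun _ _ => false) (fun _ x => x)
    (fun _ x y => x || y) false c q

theorem primrec_isTermCode : Primrec isTermCode :=
  (primrec_codeRec (α := Unit) (Primrec₂.const true)
    ((Primrec.eq.comp Primrec.snd (Primrec.const 0)).decide.to₂) Primrec₂.right
    (Primrec.and.comp (Primrec.fst.comp Primrec.snd) (Primrec.snd.comp Primrec.snd))).comp
    (Primrec.const ()) Primrec.id

theorem primrec_occursIn : Primrec₂ occursIn :=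
  primrec_codeRec ((Primrec.eq.comp Primrec.snd Primrec.fst).decide) (Primrec₂.const false)
    Primrec₂.right
    (Primrec.or.comp (Primrec.fst.comp Primrec.snd) (Primrec.snd.comp Primrec.snd))

theorem le_of_occursIn {c : ℕ} (q : ℕ) : occursIn c q = true → c ≤ q := by
  unfold occursIn
  induction q using code_cases with
  | const d =>
    rw [codeRec_const, decide_eq_true_iff]
    rintro rfl
    exact Nat.right_le_pair _ _
  | zero r => simp [codeRec_zero]
  | neg r ih =>
    rw [codeRec_neg]
    exact fun h => (ih h).trans (Nat.right_le_pair _ _)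
  | add r s ihr ihs =>
    rw [codeRec_add, Bool.or_eq_true]
    rintro (h | h)
    · exact (ihr h).trans ((Nat.left_le_pair _ _).trans (Nat.right_le_pair _ _))
    · exact (ihs h).trans ((Nat.right_le_pair _ _).trans (Nat.right_le_pair _ _))
  | invalid t r ht => simp [codeRec_invalid _ _ _ _ _ _ ht]

/-- Separates the syntactic check, which is primitive recursive, from the universe, which may need
the oracle. By `le_of_occursIn` only constants up to `q` matter. -/
theorem exists_code_eq_iff {C : Set ℕ} (q : ℕ) :
    (∃ t : GTerm C, t.code = q) ↔ isTermCode q = true ∧ ∀ c, occursIn c q = true → c ∈ C := by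
  constructor
  · rintro ⟨t, rfl⟩
    unfold isTermCode occursIn
    induction t with
    | const c =>
      simp only [GTerm.code, codeRec_const, decide_eq_true_iff, true_and]
      rintro _ rfl
      exact c.2
    | zero => simp [GTerm.code, codeRec_zero]
    | neg t ih => simpa only [GTerm.code, codeRec_neg] using ih
    | add s t ihs iht =>
      simp only [GTerm.code, codeRec_add, Bool.and_eq_true, Bool.or_eq_true]
      exact ⟨⟨ihs.1, iht.1⟩, fun c hc => hc.elim (ihs.2 c) (iht.2 c)⟩
  · unfold isTermCode occursIn
    induction q using code_cases with
    | const c =>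
      simp only [codeRec_const, decide_eq_true_iff]
      exact fun h => ⟨.const ⟨c, h.2 c rfl⟩, rfl⟩
    | zero r =>
      simp only [codeRec_zero, decide_eq_true_iff]
      rintro ⟨rfl, -⟩
      exact ⟨.zero, rfl⟩
    | neg r ih =>
      simp only [codeRec_neg]
      intro h
      obtain ⟨t, rfl⟩ := ih h
      exact ⟨.neg t, rfl⟩
    | add r s ihr ihs =>
      simp only [codeRec_add, Bool.and_eq_true, Bool.or_eq_true]
      rintro ⟨⟨hr, hs⟩, h⟩
      obtain ⟨t, rfl⟩ := ihr ⟨hr, fun c hc => h c (Or.inl hc)⟩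
      obtain ⟨u, rfl⟩ := ihs ⟨hs, fun c hc => h c (Or.inr hc)⟩
      exact ⟨.add t u, rfl⟩
    | invalid t r ht => simp [codeRec_invalid _ _ _ _ _ _ ht]

/-- A sequence of groups is uniformly computable if its universes are uniformly computable and if
the equality of the values of terms is decidable, uniformly, on Gödel numbers. -/
theorem uniformlyComputableIn_of_carrier {X : Set ℕ} {H : ℕ → NatGroup}
    (hC : ComputablePredIn X fun q : ℕ × ℕ => q.2 ∈ (H q.1).carrier)
    {E : ℕ → ℕ → Prop} (hE : PrimrecRel E)
    (hHE : ∀ n (s t : GTerm (H n).carrier), s.eval = t.eval ↔ E s.code t.code) :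
    UniformlyComputableIn X H := by
  have htag : Primrec fun q : ℕ × ℕ => q.2.unpair.1 :=
    Primrec.fst.comp (Primrec.unpair.comp Primrec.snd)
  have hterms : Primrec fun q : ℕ × ℕ => q.2.unpair.2.unpair :=
    Primrec.unpair.comp (Primrec.snd.comp (Primrec.unpair.comp Primrec.snd))
  have hs : Primrec fun q : ℕ × ℕ => q.2.unpair.2.unpair.1 := Primrec.fst.comp hterms
  have ht : Primrec fun q : ℕ × ℕ => q.2.unpair.2.unpair.2 := Primrec.snd.comp hterms
  have hE' : PrimrecPred fun q : ℕ × ℕ => E q.2.unpair.2.unpair.1 q.2.unpair.2.unpair.2 :=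
    hE.comp hs ht
  have h1 : PrimrecPred fun q : ℕ × ℕ => (isTermCode q.2.unpair.2.unpair.1 = true ∧
      isTermCode q.2.unpair.2.unpair.2 = true) ∧
      ((q.2.unpair.1 = 0 ∧ E q.2.unpair.2.unpair.1 q.2.unpair.2.unpair.2) ∨
        (q.2.unpair.1 = 1 ∧ ¬E q.2.unpair.2.unpair.1 q.2.unpair.2.unpair.2)) :=
    ((Primrec.eq.comp (primrec_isTermCode.comp hs) (Primrec.const true)).and
      (Primrec.eq.comp (primrec_isTermCode.comp ht) (Primrec.const true))).and
      (((Primrec.eq.comp htag (Primrec.const 0)).and hE').or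
        ((Primrec.eq.comp htag (Primrec.const 1)).and hE'.not))
  have h2 : ComputablePredIn X fun q : (ℕ × ℕ) × ℕ =>
      ¬(occursIn q.2 q.1.2.unpair.2.unpair.1 = true ∨
        occursIn q.2 q.1.2.unpair.2.unpair.2 = true) ∨ q.2 ∈ (H q.1.1).carrier := by
    refine ComputablePredIn.or (ComputablePredIn.not (PrimrecPred.computablePredIn ?_))
      (hC.comp (f := fun q : (ℕ × ℕ) × ℕ => (q.1.1, q.2)) (Primrec.computableIn
        ((Primrec.fst.comp Primrec.fst).pair Primrec.snd)))
    exact (Primrec.eq.comp (primrec_occursIn.comp Primrec.snd (hs.comp Primrec.fst))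
      (Primrec.const true)).or
      (Primrec.eq.comp (primrec_occursIn.comp Primrec.snd (ht.comp Primrec.fst))
        (Primrec.const true))
  refine ((h1.computablePredIn (X := X)).and (h2.forall_lt.comp (f := fun q : ℕ × ℕ => (q, q.2 + 1))
    (Primrec.computableIn (Primrec.id.pair (Primrec.succ.comp Primrec.snd))))).of_eq ?_
  rintro ⟨n, k⟩
  dsimp only
  have hle1 : k.unpair.2.unpair.1 ≤ k :=
    (Nat.unpair_left_le _).trans (Nat.unpair_right_le _)
  have hle2 : k.unpair.2.unpair.2 ≤ k :=
    (Nat.unpair_right_le _).trans (Nat.unpair_right_le _)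
  constructor
  · rintro ⟨⟨⟨hs, ht⟩, h⟩, hocc⟩
    obtain ⟨s, hs⟩ := (exists_code_eq_iff (C := (H n).carrier) _).2 ⟨hs, fun c hc =>
      (hocc c (Nat.lt_succ_of_le ((le_of_occursIn _ hc).trans hle1))).resolve_left
        (not_not.2 (Or.inl hc))⟩
    obtain ⟨t, ht⟩ := (exists_code_eq_iff (C := (H n).carrier) _).2 ⟨ht, fun c hc =>
      (hocc c (Nat.lt_succ_of_le ((le_of_occursIn _ hc).trans hle2))).resolve_left
        (not_not.2 (Or.inr hc))⟩
    rw [← hs, ← ht, ← hHE] at h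
    rcases h with ⟨htag, h⟩ | ⟨htag, h⟩
    · exact ⟨.eq s t, h, by
        rw [Literal.code, hs, ht, Nat.pair_unpair, ← htag, Nat.pair_unpair]⟩
    · exact ⟨.ne s t, h, by
        rw [Literal.code, hs, ht, Nat.pair_unpair, ← htag, Nat.pair_unpair]⟩
  · have key : ∀ s t : GTerm (H n).carrier, (isTermCode s.code = true ∧ isTermCode t.code = true) ∧
        ∀ c, ¬(occursIn c s.code = true ∨ occursIn c t.code = true) ∨ c ∈ (H n).carrier := by
      intro s t
      have h1 := (exists_code_eq_iff _).1 ⟨s, rfl⟩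
      have h2 := (exists_code_eq_iff _).1 ⟨t, rfl⟩
      exact ⟨⟨h1.1, h2.1⟩, fun c => Classical.or_iff_not_imp_left.2 fun hc =>
        (not_not.1 hc).elim (h1.2 c) (h2.2 c)⟩
    rintro ⟨φ, hφ, rfl⟩
    cases φ with
    | eq s t =>
      simp only [Literal.code, Nat.unpair_pair]
      exact ⟨⟨(key s t).1, Or.inl ⟨trivial, (hHE n s t).1 hφ⟩⟩, fun c _ => (key s t).2 c⟩
    | ne s t =>
      simp only [Literal.code, Nat.unpair_pair]
      exact ⟨⟨(key s t).1, Or.inr ⟨trivial, mt (hHE n s t).2 hφ⟩⟩, fun c _ => (key s t).2 c⟩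

end TermCodes

/-! ### Coding the ambient group by mixed radix digits -/

section MixedRadix

/-- The exponents of the cyclic summands of the ambient group, minus one. -/
def ambientExponent (i : ℕ) : ℕ := max i.unpair.1 1

variable (p : ℕ)

/-- The order of the `i`-th summand of the ambient group. -/
def radix (i : ℕ) : ℕ := p ^ (ambientExponent i + 1)

/-- The place values of the mixed radix system with the radices `radix p i`. -/
def placeValue (i : ℕ) : ℕ := Nat.rec 1 (fun i m => m * radix p i) i

/-- The digits of `g` in the mixed radix system. -/
def coord (g i : ℕ) : ℕ := g / placeValue p i % radix p i

theorem placeValue_succ (i : ℕ) : placeValue p (i + 1) = placeValue p i * radix p i := rfl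

theorem primrec_radix : Primrec (radix p) := by
  have hpow : Primrec₂ ((· ^ ·) : ℕ → ℕ → ℕ) := Primrec₂.unpaired'.1 Nat.Primrec.pow
  exact hpow.comp (Primrec.const p) (Primrec.succ.comp
    (Primrec.nat_max.comp (Primrec.fst.comp Primrec.unpair) (Primrec.const 1)))

theorem primrec_placeValue : Primrec (placeValue p) :=
  Primrec.nat_rec₁ 1 (Primrec.nat_mul.comp Primrec.snd ((primrec_radix p).comp Primrec.fst)).to₂

theorem primrec_coord : Primrec₂ (coord p) :=
  Primrec.nat_mod.comp (Primrec.nat_div.comp Primrec.fst ((primrec_placeValue p).comp Primrec.snd))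
    ((primrec_radix p).comp Primrec.snd)

variable {p}

theorem placeValue_dvd {i j : ℕ} (h : i ≤ j) : placeValue p i ∣ placeValue p j := by
  induction h with
  | refl => exact dvd_rfl
  | step _ ih => exact ih.trans (Dvd.intro _ rfl)

theorem coord_eq_zero_of_lt {g i : ℕ} (h : g < placeValue p i) : coord p g i = 0 := by
  rw [coord, Nat.div_eq_of_lt h, Nat.zero_mod]

theorem zmod_radix_cast_eq_zero {i a : ℕ} :
    ((a : ZMod (p ^ (ambientExponent i + 1))) = 0) ↔ a % radix p i = 0 := by
  rw [ZMod.natCast_eq_zero_iff, Nat.dvd_iff_mod_eq_zero]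
  rfl

variable [hp : Fact p.Prime]

theorem radix_pos (i : ℕ) : 0 < radix p i := pow_pos hp.out.pos _

theorem coord_lt (g i : ℕ) : coord p g i < radix p i := Nat.mod_lt _ (radix_pos i)

theorem placeValue_pos (i : ℕ) : 0 < placeValue p i := by
  induction i with
  | zero => exact Nat.one_pos
  | succ i ih => exact Nat.mul_pos ih (radix_pos i)

theorem lt_placeValue (i : ℕ) : i < placeValue p i := by
  induction i with
  | zero => exact Nat.one_pos
  | succ i ih =>
    rw [placeValue_succ]
    have h2 : 2 ≤ radix p i := hp.out.two_le.trans (Nat.le_self_pow (by omega) p)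
    have := Nat.mul_le_mul_left (placeValue p i) h2
    omega

/-- Place values outgrow their indices, so a number bounds the positions of its own nonzero digits.
The index bounds in `ambientValue`, `LegalAt` and `TermCoordEq` rest on this. -/
theorem coord_eq_zero {g i : ℕ} (h : g ≤ i) : coord p g i = 0 :=
  coord_eq_zero_of_lt (h.trans_lt (lt_placeValue i))

theorem coord_injective {g g' : ℕ} (h : ∀ i, coord p g i = coord p g' i) : g = g' := by
  have key : ∀ i, g % placeValue p i = g' % placeValue p i := by
    intro i
    induction i with
    | zero => simp [placeValue, Nat.mod_one]
    | succ i ih =>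
      have := h i
      rw [coord, coord] at this
      rw [placeValue_succ, Nat.mod_mul, Nat.mod_mul, ih, this]
  have := key (g + g')
  have hlt := lt_placeValue (p := p) (g + g')
  rwa [Nat.mod_eq_of_lt (by omega), Nat.mod_eq_of_lt (by omega)] at this

theorem exists_coord_eq {f : ℕ → ℕ} (hf : ∀ i, f i < radix p i) (N : ℕ) :
    ∃ g < placeValue p N, ∀ i < N, coord p g i = f i := by
  induction N with
  | zero => exact ⟨0, placeValue_pos 0, by simp⟩
  | succ N ih =>
    obtain ⟨g, hg, hgf⟩ := ih
    refine ⟨g + placeValue p N * f N, ?_, fun i hi => ?_⟩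
    · rw [placeValue_succ]
      calc g + placeValue p N * f N < placeValue p N * (f N + 1) := by rw [mul_add]; omega
        _ ≤ _ := Nat.mul_le_mul_left _ (hf N)
    · rcases Nat.lt_succ_iff_lt_or_eq.1 hi with hi | rfl
      · obtain ⟨k, hk⟩ := placeValue_dvd (p := p) (Nat.succ_le_of_lt hi)
        rw [← hgf i hi, coord, coord, hk, Nat.succ_eq_add_one, placeValue_succ, mul_assoc, mul_assoc,
          Nat.add_mul_div_left _ _ (placeValue_pos i), Nat.add_mul_mod_self_left]
      · rw [coord, Nat.add_mul_div_left _ _ (placeValue_pos i), Nat.div_eq_of_lt hg, zero_add,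
          Nat.mod_eq_of_lt (hf i)]

variable (p) in
/-- The element of the ambient group with the digits of `g` as coordinates. -/
def ambientValue (g : ℕ) : CyclicSum p ambientExponent :=
  DFinsupp.mk (Finset.range g) fun i => (coord p g i : ZMod _)

theorem ambientValue_apply (g i : ℕ) :
    ambientValue p g i = (coord p g i : ZMod (p ^ (ambientExponent i + 1))) := by
  refine DFinsupp.mk_apply.trans ?_
  split_ifs with h
  · rfl
  · rw [coord_eq_zero (by simpa using h), Nat.cast_zero]

theorem ambientValue_injective : Function.Injective (ambientValue p) := by
  intro g g' h
  refine coord_injective (p := p) fun i => ?_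
  have h1 := DFinsupp.ext_iff.1 h i
  rw [ambientValue_apply, ambientValue_apply, ZMod.natCast_eq_natCast_iff] at h1
  exact Nat.ModEq.eq_of_lt_of_lt h1 (coord_lt g i) (coord_lt g' i)

theorem ambientValue_surjective : Function.Surjective (ambientValue p) := by
  classical
  have : NeZero p := ⟨hp.out.ne_zero⟩
  intro x
  obtain ⟨g, hg, hgx⟩ := exists_coord_eq (p := p) (f := fun i => (x i).val)
    (fun i => ZMod.val_lt _) (x.support.sup id + 1)
  refine ⟨g, DFinsupp.ext fun i => ?_⟩
  rw [ambientValue_apply]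
  by_cases hi : i < x.support.sup id + 1
  · rw [hgx i hi, ZMod.natCast_zmod_val]
  · have h0 : x i = 0 := by
      by_contra h
      have := Finset.le_sup (f := id) (DFinsupp.mem_support_iff.2 h)
      simp only [id] at this
      omega
    rw [h0, coord_eq_zero_of_lt, Nat.cast_zero]
    exact hg.trans_le (Nat.le_of_dvd (placeValue_pos i) (placeValue_dvd (by omega)))

end MixedRadix

/-! ### The group built from a `Π⁰₁` condition -/

section PresentedGroups

/-- The group structure on `C ⊆ ℕ` transported along a bijection with a group. -/
def NatGroup.ofBijOn {B : Type} [AddCommGroup B] {C : Set ℕ} {K : AddSubgroup B} {v : ℕ → B}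
    (h : Set.BijOn v C K) : NatGroup :=
  @NatGroup.mk C (Equiv.addCommGroup (β := K) (Set.BijOn.equiv v h))

/-- The isomorphism along which the group structure is transported. -/
def NatGroup.ofBijOnEquiv {B : Type} [AddCommGroup B] {C : Set ℕ} {K : AddSubgroup B} {v : ℕ → B}
    (h : Set.BijOn v C K) : (NatGroup.ofBijOn h).carrier ≃+ K :=
  @Equiv.addEquiv C K (Set.BijOn.equiv v h) _

variable (p : ℕ) (Q : ℕ → ℕ → Prop)

/-- The exponents of the summands of the presented group, minus one: the summands with the indices
`(0, v)` have order `p` if `Q v z` holds for no `z`. -/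
def finalExponent (i : ℕ) : ℕ :=
  open Classical in if i.unpair.1 = 0 ∧ ∀ z, ¬Q i.unpair.2 z then 0 else ambientExponent i

theorem finalExponent_le (i : ℕ) : finalExponent Q i ≤ ambientExponent i := by
  unfold finalExponent
  split_ifs
  · exact Nat.zero_le _
  · exact le_rfl

/-- By stage `s` it is known that the digits of `g` are those of an element of the presented
group. -/
def LegalAt (g s : ℕ) : Prop :=
  ∀ i < g, i.unpair.1 ≠ 0 ∨ p * coord p g i % radix p i = 0 ∨ ∃ z < s, Q i.unpair.2 z

/-- The universe of the presented group: the codes of pairs consisting of an element of the ambient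
group and of the stage at which it becomes legal. -/
def presentedCarrier : Set ℕ :=
  {c | LegalAt p Q c.unpair.1 c.unpair.2 ∧ ∀ t < c.unpair.2, ¬LegalAt p Q c.unpair.1 t}

/-- The presented group, as a subgroup of the ambient group. -/
def presentedSubgroup : AddSubgroup (CyclicSum p ambientExponent) where
  carrier := {x | ∀ i, p ^ (finalExponent Q i + 1) • x i = 0}
  zero_mem' i := smul_zero _
  add_mem' {x y} hx hy i := by
    change p ^ (finalExponent Q i + 1) • (x i + y i) = 0
    rw [smul_add, hx i, hy i, add_zero]
  neg_mem' {x} hx i := by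
    change p ^ (finalExponent Q i + 1) • -x i = 0
    rw [smul_neg, hx i, neg_zero]

variable {p Q} [hp : Fact p.Prime]

/-- Where the exponent is not lowered, membership imposes no condition. Only the finitely many
positions below `g` matter, so their witnesses `z` fit under a common stage. -/
theorem ambientValue_mem_iff {g : ℕ} :
    ambientValue p g ∈ presentedSubgroup p Q ↔ ∃ s, LegalAt p Q g s := by
  have h1 : ∀ i, p ^ (finalExponent Q i + 1) • ambientValue p g i = 0 ↔
      i.unpair.1 ≠ 0 ∨ p * coord p g i % radix p i = 0 ∨ ∃ z, Q i.unpair.2 z := by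
    intro i
    by_cases hi : i.unpair.1 = 0 ∧ ∀ z, ¬Q i.unpair.2 z
    · rw [finalExponent, if_pos hi, zero_add, pow_one, ambientValue_apply, _root_.nsmul_eq_mul,
        ← Nat.cast_mul, zmod_radix_cast_eq_zero]
      simp only [hi.1, hi.2, ne_eq, not_true_eq_false, false_or, exists_false, or_false]
    · rw [finalExponent, if_neg hi]
      refine iff_of_true (pow_nsmul_zmod_eq_zero le_rfl _) ?_
      by_contra! hc
      exact hi ⟨hc.1, hc.2.2⟩
  change (∀ i, p ^ (finalExponent Q i + 1) • ambientValue p g i = 0) ↔ _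
  simp only [h1]
  constructor
  · intro h
    have : ∀ N, ∃ s, ∀ i < N, i.unpair.1 ≠ 0 ∨ p * coord p g i % radix p i = 0 ∨
        ∃ z < s, Q i.unpair.2 z := by
      intro N
      induction N with
      | zero => exact ⟨0, by simp⟩
      | succ N ih =>
        obtain ⟨s, hs⟩ := ih
        have hmono : ∀ t, s ≤ t → ∀ i < N, i.unpair.1 ≠ 0 ∨ p * coord p g i % radix p i = 0 ∨
            ∃ z < t, Q i.unpair.2 z := fun t hst i hi =>
          (hs i hi).imp_right (Or.imp_right fun ⟨z, hz, hQ⟩ => ⟨z, hz.trans_le hst, hQ⟩)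
        rcases h N with hN | hN | ⟨z, hN⟩
        · exact ⟨s, Nat.forall_lt_succ_right.2 ⟨hmono s le_rfl, Or.inl hN⟩⟩
        · exact ⟨s, Nat.forall_lt_succ_right.2 ⟨hmono s le_rfl, Or.inr (Or.inl hN)⟩⟩
        · exact ⟨max s (z + 1), Nat.forall_lt_succ_right.2 ⟨hmono _ (le_max_left _ _),
            Or.inr (Or.inr ⟨z, Nat.lt_of_succ_le (le_max_right _ _), hN⟩)⟩⟩
    exact this g
  · rintro ⟨s, hs⟩ i
    by_cases hi : i < g
    · exact (hs i hi).imp_right (Or.imp_right fun ⟨z, _, hQ⟩ => ⟨z, hQ⟩)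
    · rw [coord_eq_zero (not_lt.1 hi)]
      exact Or.inr (Or.inl (Nat.zero_mod _))

variable (p Q) in
-- The first legal stage is a function of `g`, so tagging with it gives each element exactly one
-- code.
theorem bijOn_presented :
    Set.BijOn (fun c : ℕ => ambientValue p c.unpair.1) (presentedCarrier p Q)
      (presentedSubgroup p Q) := by
  refine ⟨fun c hc => ambientValue_mem_iff.2 ⟨_, hc.1⟩, fun c hc d hd h => ?_, fun x hx => ?_⟩
  · have h1 : c.unpair.1 = d.unpair.1 := ambientValue_injective (p := p) h
    have h2 : c.unpair.2 = d.unpair.2 := by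
      have hc1 := hc.1
      have hd1 := hd.1
      rw [h1] at hc1
      rw [← h1] at hd1
      exact le_antisymm (not_lt.1 fun hlt => hc.2 _ hlt hd1) (not_lt.1 fun hlt => hd.2 _ hlt hc1)
    rw [← Nat.pair_unpair c, h1, h2, Nat.pair_unpair]
  · obtain ⟨g, rfl⟩ := ambientValue_surjective x
    have hex := ambientValue_mem_iff.1 hx
    classical
    refine ⟨Nat.pair g (Nat.find hex), ?_, by simp⟩
    rw [presentedCarrier, Set.mem_ofPred_eq, Nat.unpair_pair]
    exact ⟨Nat.find_spec hex, fun t ht => Nat.find_min hex ht⟩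

variable (p) in
/-- Multiplication by `p ^ (n - m)`, as an embedding of `ℤ/p^(m+1)` into `ℤ/p^(n+1)`. -/
theorem exists_zmod_embedding {m n : ℕ} (hmn : m ≤ n) :
    ∃ f : ZMod (p ^ (m + 1)) →+ ZMod (p ^ (n + 1)), Function.Injective f ∧
      ∀ y, y ∈ f.range ↔ p ^ (m + 1) • y = 0 := by
  have hp0 : NeZero p := ⟨hp.out.ne_zero⟩
  have hadd : (n - m) + (m + 1) = n + 1 := by omega
  let f : ZMod (p ^ (m + 1)) →+ ZMod (p ^ (n + 1)) :=
    ZMod.lift _ ⟨zmultiplesHom _ ((p ^ (n - m) : ℕ) : ZMod (p ^ (n + 1))), by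
      rw [zmultiplesHom_apply, natCast_zsmul, _root_.nsmul_eq_mul, ← Nat.cast_mul, mul_comm, ← pow_add, hadd,
        ZMod.natCast_self]⟩
  have hf : ∀ a : ℕ, f a = ((p ^ (n - m) * a : ℕ) : ZMod (p ^ (n + 1))) := fun a => by
    rw [← Int.cast_natCast (R := ZMod (p ^ (m + 1)))]
    refine (ZMod.lift_coe _ _ _).trans ?_
    rw [zmultiplesHom_apply, natCast_zsmul, _root_.nsmul_eq_mul, ← Nat.cast_mul, mul_comm]
  have hdvd : p ^ (n + 1) = p ^ (n - m) * p ^ (m + 1) := by rw [← pow_add, hadd]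
  refine ⟨f, (injective_iff_map_eq_zero f).2 fun x hx => ?_, fun y => ⟨?_, fun hy => ?_⟩⟩
  · obtain ⟨a, rfl⟩ := ZMod.natCast_zmod_surjective x
    rw [hf, ZMod.natCast_eq_zero_iff, hdvd] at hx
    exact (ZMod.natCast_eq_zero_iff _ _).2
      (Nat.dvd_of_mul_dvd_mul_left (pow_pos hp.out.pos _) hx)
  · rintro ⟨x, rfl⟩
    rw [← map_nsmul, pow_nsmul_zmod_eq_zero le_rfl, map_zero]
  · obtain ⟨a, rfl⟩ := ZMod.natCast_zmod_surjective y
    rw [_root_.nsmul_eq_mul, ← Nat.cast_mul, ZMod.natCast_eq_zero_iff, hdvd, mul_comm] at hy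
    obtain ⟨b, rfl⟩ := Nat.dvd_of_mul_dvd_mul_left (pow_pos hp.out.pos _) hy
    exact ⟨b, hf b⟩

/-- Each small cyclic group embeds onto the torsion that defines the subgroup in that coordinate. -/
theorem nonempty_cyclicSum_equiv_presentedSubgroup :
    Nonempty (CyclicSum p (finalExponent Q) ≃+ presentedSubgroup p Q) := by
  choose f hf hfr using fun i => exists_zmod_embedding p (finalExponent_le Q i)
  let Φ := DFinsupp.mapRange.addMonoidHom f
  have hΦ : Function.Injective Φ := 
    (DFinsupp.mapRange_injective (fun i => f i) fun i => map_zero _).2 hf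
  have hr : Φ.range = presentedSubgroup p Q := by
    ext x
    constructor
    · rintro ⟨y, rfl⟩ i
      exact (hfr i _).1 ⟨y i, rfl⟩
    · exact fun hx => mem_range_dfinsupp_mapRange f fun i => (hfr i _).2 (hx i)
  exact ⟨(AddMonoidHom.ofInjective hΦ).trans (AddEquiv.addSubgroupCongr hr)⟩

variable (p Q) in
/-- The presented group on its universe. -/
def presentedGroup : NatGroup := NatGroup.ofBijOn (bijOn_presented p Q)

theorem nonempty_presentedGroup_equiv :
    Nonempty ((presentedGroup p Q).carrier ≃+ CyclicSum p (finalExponent Q)) := by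
  obtain ⟨e⟩ := nonempty_cyclicSum_equiv_presentedSubgroup (p := p) (Q := Q)
  exact ⟨(NatGroup.ofBijOnEquiv (bijOn_presented p Q)).trans e.symm⟩

theorem isReduced_presentedGroup :
    IsReducedPGroupOfLengthLeOmega p (presentedGroup p Q).carrier := by
  obtain ⟨e⟩ := nonempty_presentedGroup_equiv (p := p) (Q := Q)
  exact isReducedPGroupOfLengthLeOmega_iff.2
    ⟨(isAbelianPGroup_cyclicSum _).map e.symm, (isPSeparated_cyclicSum _).map e.symm⟩

/-- For `k ≥ 1` the indices `(k, v)` already give infinitely many summands of order `p^(k+1)`, and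
extra ones of order `p^2` do no harm. Only `k = 0` carries information, since ambient exponents are
at least `1`. -/
theorem presentedGroup_equiv_gOmega_iff :
    Nonempty ((presentedGroup p Q).carrier ≃+ GOmega p) ↔ {v | ∀ z, ¬Q v z}.Infinite := by
  obtain ⟨e⟩ := nonempty_presentedGroup_equiv (p := p) (Q := Q)
  have h1 : Nonempty ((presentedGroup p Q).carrier ≃+ GOmega p) ↔
      Nonempty (CyclicSum p (finalExponent Q) ≃+ CyclicSum p (Prod.fst : ℕ × ℕ → ℕ)) :=
    ⟨fun ⟨f⟩ => ⟨e.symm.trans f⟩, fun ⟨f⟩ => ⟨e.trans f⟩⟩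
  rw [h1, cyclicSum_equiv_iff]
  have hinf : ∀ k, Infinite {j : ℕ × ℕ // j.1 = k} := fun k =>
    Infinite.of_injective (fun v : ℕ => ⟨(k, v), rfl⟩) fun v w h => by simpa using h
  have h2 : ∀ k, Nonempty ({i // finalExponent Q i = k} ≃ {j : ℕ × ℕ // j.1 = k}) ↔
      {i | finalExponent Q i = k}.Infinite := fun k => by
    rw [← Set.infinite_coe_iff]
    constructor
    · rintro ⟨f⟩
      have := hinf k
      exact f.infinite_iff.2 this
    · intro h
      have := hinf k
      have h' : Infinite {i // finalExponent Q i = k} := h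
      obtain ⟨_⟩ := nonempty_denumerable {i // finalExponent Q i = k}
      obtain ⟨_⟩ := nonempty_denumerable {j : ℕ × ℕ // j.1 = k}
      exact ⟨Denumerable.equiv₂ _ _⟩
  simp only [h2]
  have h3 : {i | finalExponent Q i = 0} = Nat.pair 0 '' {v | ∀ z, ¬Q v z} := by
    ext i
    constructor
    · intro hi
      rw [Set.mem_ofPred_eq, finalExponent] at hi
      split_ifs at hi with h
      · exact ⟨_, h.2, by rw [← h.1, Nat.pair_unpair]⟩
      · rw [ambientExponent] at hi
        omega
    · rintro ⟨v, hv, rfl⟩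
      rw [Set.mem_ofPred_eq, finalExponent, if_pos]
      rw [Nat.unpair_pair]
      exact ⟨rfl, hv⟩
  constructor
  · intro h
    have := h 0
    rw [h3] at this
    exact this.of_image _
  · intro h k
    rcases Nat.eq_zero_or_pos k with rfl | hk
    · rw [h3]
      exact h.image fun v _ w _ hvw => (Nat.pair_eq_pair.1 hvw).2
    · refine Set.infinite_of_injective_forall_mem (f := Nat.pair k)
        (fun v w h => (Nat.pair_eq_pair.1 h).2) fun v => ?_
      rw [Set.mem_ofPred_eq, finalExponent, if_neg, ambientExponent, Nat.unpair_pair]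
      · exact max_eq_left hk
      · rw [Nat.unpair_pair]
        exact fun h => hk.ne' h.1

end PresentedGroups

/-! ### Uniform computability of the construction -/

section UniformPresentation

variable (p : ℕ)

/-- A representative of the `i`-th coordinate of the value of a term, computed from its Gödel
number. -/
def termCoord (i q : ℕ) : ℕ :=
  codeRec (fun i c => coord p c.unpair.1 i) (fun _ _ => 0) (fun i x => (radix p i - 1) * x)
    (fun _ x y => x + y) 0 i q

/-- Equality of the values of terms, computed from their Gödel numbers. -/
def TermCoordEq (a b : ℕ) : Prop :=
  ∀ i < a + b, termCoord p i a % radix p i = termCoord p i b % radix p i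

theorem primrec_termCoord : Primrec₂ (termCoord p) :=
  primrec_codeRec
    ((primrec_coord p).comp (Primrec.fst.comp (Primrec.unpair.comp Primrec.snd)) Primrec.fst)
    (Primrec₂.const 0)
    (Primrec.nat_mul.comp (Primrec.pred.comp ((primrec_radix p).comp Primrec.fst)) Primrec.snd)
    (Primrec.nat_add.comp (Primrec.fst.comp Primrec.snd) (Primrec.snd.comp Primrec.snd))

theorem primrecRel_termCoordEq : PrimrecRel (TermCoordEq p) := by
  have h : PrimrecRel fun (i : ℕ) (q : ℕ × ℕ) =>
      termCoord p i q.1 % radix p i = termCoord p i q.2 % radix p i := by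
    have hr : Primrec fun q : ℕ × (ℕ × ℕ) => radix p q.1 := (primrec_radix p).comp Primrec.fst
    exact Primrec.eq.comp
      (Primrec.nat_mod.comp ((primrec_termCoord p).comp Primrec.fst
        (Primrec.fst.comp Primrec.snd)) hr)
      (Primrec.nat_mod.comp ((primrec_termCoord p).comp Primrec.fst
        (Primrec.snd.comp Primrec.snd)) hr)
  have h' : PrimrecPred fun q : ℕ × ℕ => ∀ i ∈ List.range (q.1 + q.2),
      termCoord p i q.1 % radix p i = termCoord p i q.2 % radix p i :=
    h.forall_mem_list.comp (Primrec.list_range.comp (Primrec.nat_add.comp Primrec.fst Primrec.snd))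
      Primrec.id
  exact h'.of_eq fun q => by simp [TermCoordEq]

variable {p} [hp : Fact p.Prime]

theorem termCoord_eq_zero {i : ℕ} (q : ℕ) : q ≤ i → termCoord p i q = 0 := by
  unfold termCoord
  induction q using code_cases with
  | const c =>
    rw [codeRec_const]
    exact fun h => coord_eq_zero ((Nat.unpair_left_le c).trans ((Nat.right_le_pair 0 c).trans h))
  | zero r => simp [codeRec_zero]
  | neg r ih =>
    rw [codeRec_neg]
    exact fun h => by rw [ih ((Nat.right_le_pair _ _).trans h), mul_zero]
  | add r s ihr ihs =>
    rw [codeRec_add]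
    exact fun h => by
      rw [ihr ((Nat.left_le_pair _ _).trans ((Nat.right_le_pair _ _).trans h)),
        ihs ((Nat.right_le_pair _ _).trans ((Nat.right_le_pair _ _).trans h))]
  | invalid t r ht => simp [codeRec_invalid _ _ _ _ _ _ ht]

variable {Q : ℕ → ℕ → Prop}

variable (p Q) in
/-- The value in the ambient group of an element of the presented group. -/
def presentedEquiv : (presentedGroup p Q).carrier ≃+ presentedSubgroup p Q :=
  NatGroup.ofBijOnEquiv (bijOn_presented p Q)

theorem presentedEquiv_apply (c : (presentedGroup p Q).carrier) :
    (presentedEquiv p Q c : CyclicSum p ambientExponent) = ambientValue p c.1.unpair.1 := rfl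

theorem termCoord_code (t : GTerm (presentedGroup p Q).carrier) (i : ℕ) :
    (termCoord p i t.code : ZMod (p ^ (ambientExponent i + 1))) =
      (presentedEquiv p Q t.eval).1 i := by
  unfold termCoord
  induction t with
  | const c =>
    rw [GTerm.code, codeRec_const, GTerm.eval, presentedEquiv_apply, ambientValue_apply]
  | zero =>
    rw [GTerm.code, codeRec_zero, GTerm.eval, Nat.cast_zero]
    exact (DFinsupp.ext_iff.1 (congrArg Subtype.val (map_zero (presentedEquiv p Q))) i).symm
  -- The factor `radix p i - 1` represents `-1`, which keeps the computation in `ℕ`.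
  | neg t ih =>
    rw [GTerm.code, codeRec_neg, GTerm.eval, Nat.cast_mul, ih,
      Nat.cast_sub (Nat.succ_le_of_lt (radix_pos i)), radix, ZMod.natCast_self, Nat.cast_one,
      _root_.zero_sub, neg_one_mul]
    exact (DFinsupp.ext_iff.1 (congrArg Subtype.val (map_neg (presentedEquiv p Q) t.eval)) i).symm
  | add s t ihs iht =>
    rw [GTerm.code, codeRec_add, GTerm.eval, Nat.cast_add, ihs, iht]
    exact (DFinsupp.ext_iff.1 (congrArg Subtype.val (map_add (presentedEquiv p Q) s.eval t.eval)) i).symm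

theorem eval_eq_iff_termCoordEq (s t : GTerm (presentedGroup p Q).carrier) :
    s.eval = t.eval ↔ TermCoordEq p s.code t.code := by
  have h1 : ∀ i, (presentedEquiv p Q s.eval).1 i =
      (presentedEquiv p Q t.eval).1 i ↔
      termCoord p i s.code % radix p i = termCoord p i t.code % radix p i := fun i => by
    rw [← termCoord_code, ← termCoord_code, ZMod.natCast_eq_natCast_iff]
    rfl
  rw [← (presentedEquiv p Q).injective.eq_iff, Subtype.ext_iff,
    DFinsupp.ext_iff]
  simp only [h1]
  refine ⟨fun h i _ => h i, fun h i => ?_⟩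
  by_cases hi : i < s.code + t.code
  · exact h i hi
  · rw [termCoord_eq_zero _ (by omega), termCoord_eq_zero _ (by omega)]

variable (p) in
-- Equality of terms is decided in the ambient group, independently of `Q`; the oracle enters only
-- through the universe, by bounded questions about `Q`.
theorem uniformlyComputableIn_presentedGroup {X : Set ℕ} {Q : ℕ × ℕ × ℕ → Prop}
    (hQ : ComputablePredIn X Q) :
    UniformlyComputableIn X fun n => presentedGroup p fun v z => Q (n, v, z) := by
  refine uniformlyComputableIn_of_carrier ?_ (primrecRel_termCoordEq p)
    fun n => eval_eq_iff_termCoordEq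
  have hex : ComputablePredIn X fun q : ((ℕ × ℕ × ℕ) × ℕ) =>
      ∃ z < q.1.2.2, Q (q.1.1, q.2.unpair.2, z) := by
    have h1 : ComputablePredIn X fun q : (ℕ × ℕ) × ℕ => Q (q.1.1, q.1.2, q.2) :=
      hQ.comp (Primrec.computableIn ((Primrec.fst.comp Primrec.fst).pair
        ((Primrec.snd.comp Primrec.fst).pair Primrec.snd)))
    exact h1.exists_lt.comp
      (f := fun q : ((ℕ × ℕ × ℕ) × ℕ) => ((q.1.1, q.2.unpair.2), q.1.2.2))
      (Primrec.computableIn (((Primrec.fst.comp Primrec.fst).pair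
        (Primrec.snd.comp (Primrec.unpair.comp Primrec.snd))).pair
        (Primrec.snd.comp (Primrec.snd.comp Primrec.fst))))
  have hlegal : ComputablePredIn X fun q : ℕ × ℕ × ℕ =>
      LegalAt p (fun v z => Q (q.1, v, z)) q.2.1 q.2.2 := by
    have h1 : ComputablePredIn X fun q : ((ℕ × ℕ × ℕ) × ℕ) =>
        q.2.unpair.1 ≠ 0 ∨ p * coord p q.1.2.1 q.2 % radix p q.2 = 0 ∨
          ∃ z < q.1.2.2, Q (q.1.1, q.2.unpair.2, z) := by
      refine ComputablePredIn.or (PrimrecPred.computablePredIn ?_)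
        (ComputablePredIn.or (PrimrecPred.computablePredIn ?_) hex)
      · exact (Primrec.eq.comp (Primrec.fst.comp (Primrec.unpair.comp Primrec.snd))
          (Primrec.const 0)).not
      · exact Primrec.eq.comp (Primrec.nat_mod.comp (Primrec.nat_mul.comp (Primrec.const p)
          ((primrec_coord p).comp (Primrec.fst.comp (Primrec.snd.comp Primrec.fst)) Primrec.snd))
          ((primrec_radix p).comp Primrec.snd)) (Primrec.const 0)
    exact h1.forall_lt.comp (f := fun q : ℕ × ℕ × ℕ => (q, q.2.1))
      (Primrec.computableIn (Primrec.id.pair (Primrec.fst.comp Primrec.snd)))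
  have hc : Primrec fun q : ℕ × ℕ => q.2.unpair := Primrec.unpair.comp Primrec.snd
  have hg : ComputablePredIn X fun q : (ℕ × ℕ) × ℕ =>
      ¬LegalAt p (fun v z => Q (q.1.1, v, z)) q.1.2 q.2 :=
    (hlegal.comp (f := fun q : (ℕ × ℕ) × ℕ => (q.1.1, q.1.2, q.2))
      (Primrec.computableIn ((Primrec.fst.comp Primrec.fst).pair
        ((Primrec.snd.comp Primrec.fst).pair Primrec.snd)))).not
  exact ComputablePredIn.and
    (hlegal.comp (f := fun q : ℕ × ℕ => (q.1, q.2.unpair.1, q.2.unpair.2))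
      (Primrec.computableIn (Primrec.fst.pair ((Primrec.fst.comp hc).pair (Primrec.snd.comp hc)))))
    (hg.forall_lt.comp (f := fun q : ℕ × ℕ => ((q.1, q.2.unpair.1), q.2.unpair.2))
      (Primrec.computableIn ((Primrec.fst.pair (Primrec.fst.comp hc)).pair (Primrec.snd.comp hc))))

variable (p) in
/-- Every `Π⁰₃` set is reducible, uniformly, to the set of presentations of `G^ω`. -/
theorem exists_uniform_sequence (X S : Set ℕ) (hS : IsPi03In X S) :
    ∃ H : ℕ → NatGroup, UniformlyComputableIn X H ∧
      (∀ n, IsReducedPGroupOfLengthLeOmega p (H n).carrier) ∧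
      ∀ n, Nonempty ((H n).carrier ≃+ GOmega p) ↔ n ∈ S := by
  obtain ⟨Q, hQ, hS⟩ := hS.exists_infinite_iff
  exact ⟨_, uniformlyComputableIn_presentedGroup p hQ, fun n => isReduced_presentedGroup,
    fun n => presentedGroup_equiv_gOmega_iff.trans (hS n).symm⟩

end UniformPresentation

/-! ### Indices for uniformly computable sequences -/

section Hardness

/-- The s-m-n theorem, applied to a program that halts on `(n, k)` exactly when `P n k`. -/
theorem exists_computable_index {P : ℕ → ℕ → Prop}
    (hP : ComputablePred fun q : ℕ × ℕ => P q.1 q.2) :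
    ∃ f : ℕ → ℕ, Computable f ∧ ∀ n, W (f n) = {k | P n k} := by
  have h1 : Partrec fun n : ℕ => Part.assert (P n.unpair.1 n.unpair.2) fun _ => Part.some () :=
    Partrec.comp hP.to_re Computable.unpair
  obtain ⟨c, hc⟩ := Nat.Partrec.Code.exists_code.1
    (Partrec.nat_iff.1 (h1.map ((Computable.const 0).to₂ : Computable₂ fun _ _ => 0)))
  refine ⟨fun n => Encodable.encode (c.curry n), Computable.encode.comp
    (Nat.Partrec.Code.primrec₂_curry.to_comp.comp (Computable.const c) Computable.id),
    fun n => Set.ext fun k => ?_⟩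
  rw [W, Set.mem_ofPred_eq, Denumerable.ofNat_encode, Nat.Partrec.Code.eval_curry, hc]
  simp [Part.assert]

variable {p : ℕ}

theorem uniformlyComputableIn_empty {H : ℕ → NatGroup} (hH : UniformlyComputableIn ∅ H) :
    ComputablePred fun q : ℕ × ℕ => q.2 ∈ (H q.1).diagram :=
  ComputablePredIn.computablePred hH

theorem isComputable_of_uniform {H : ℕ → NatGroup} (hH : UniformlyComputableIn ∅ H) (n : ℕ) :
    (H n).IsComputable := by
  obtain ⟨_, h⟩ := uniformlyComputableIn_empty hH
  exact ⟨fun k => Classical.dec _, (h.comp ((Computable.const n).pair Computable.id)).of_eq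
    fun k => by congr⟩

theorem IsPi03.isPi03In {S : Set ℕ} (h : IsPi03 S) (X : Set ℕ) : IsPi03In X S := by
  obtain ⟨R, hR, hS⟩ := h
  exact ⟨R, hR.computablePredIn, hS⟩

end Hardness

/-! ### Invariants as `Σ⁰₂` conditions on indices -/

section DiagramFormulas

theorem exists_primrec_surjective (α : Type*) [Primcodable α] [Inhabited α] :
    ∃ f : ℕ → α, Primrec f ∧ Function.Surjective f :=
  ⟨_, Primrec.option_getD_default.comp Primrec.decode,
    fun a => ⟨Encodable.encode a, by rw [Encodable.encodek, Option.getD_some]⟩⟩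

theorem isPi03_of_primrecPred {α : Type} {β γ δ : Type*} [Primcodable α] [Primcodable β]
    [Primcodable γ] [Primcodable δ] [Inhabited β] [Inhabited γ] [Inhabited δ]
    {M : α × β × γ × δ → Prop} (hM : PrimrecPred M) :
    IsPi03 {a | ∀ x, ∃ y, ∀ z, M (a, x, y, z)} := by
  obtain ⟨f, hf, hf'⟩ := exists_primrec_surjective β
  obtain ⟨g, hg, hg'⟩ := exists_primrec_surjective γ
  obtain ⟨h, hh, hh'⟩ := exists_primrec_surjective δ
  refine ⟨fun q => M (q.1, f q.2.1, g q.2.2.1, h q.2.2.2), PrimrecPred.computablePred (hM.comp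
    (Primrec.fst.pair ((hf.comp (Primrec.fst.comp Primrec.snd)).pair
      ((hg.comp (Primrec.fst.comp (Primrec.snd.comp Primrec.snd))).pair
        (hh.comp (Primrec.snd.comp (Primrec.snd.comp Primrec.snd))))))), fun a => ?_⟩
  simp only [Set.mem_ofPred_eq, hf'.forall, hg'.exists, hh'.forall]

/-- The sum of `m` copies of a constant. -/
def multipleTerm {α : Type} (m : ℕ) (c : α) : GTerm α :=
  Nat.rec .zero (fun _ t => .add t (.const c)) m

theorem eval_multipleTerm {α : Type} [AddCommGroup α] (m : ℕ) (c : α) :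
    (multipleTerm m c).eval = m • c := by
  induction m with
  | zero => exact (zero_nsmul c).symm
  | succ m ih =>
    change (multipleTerm m c).eval + c = _
    rw [ih, succ_nsmul]

/-- The Gödel number of the sum of `m` copies of the constant `c`. -/
def multipleCode (m c : ℕ) : ℕ :=
  Nat.rec (Nat.pair 1 0) (fun _ t => Nat.pair 3 (Nat.pair t (Nat.pair 0 c))) m

theorem code_multipleTerm {C : Set ℕ} (m : ℕ) (c : C) :
    (multipleTerm m c).code = multipleCode m c := by
  induction m with
  | zero => rfl
  | succ m ih =>
    change Nat.pair 3 (Nat.pair (multipleTerm m c).code (Nat.pair 0 c)) = _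
    rw [ih]
    rfl

theorem primrec_multipleCode : Primrec₂ multipleCode := by
  have hstep : Primrec fun q : ℕ × ℕ × ℕ => Nat.pair 3 (Nat.pair q.2.2 (Nat.pair 0 q.1)) :=
    Primrec₂.natPair.comp (Primrec.const 3) (Primrec₂.natPair.comp (Primrec.snd.comp Primrec.snd)
      (Primrec₂.natPair.comp (Primrec.const 0) Primrec.fst))
  exact (Primrec.nat_rec (f := fun _ : ℕ => Nat.pair 1 0) (Primrec.const _) hstep.to₂).swap

/-- For `m = 0` the term is `0`, which does not mention `c`. -/
theorem mem_of_code_eq_multipleCode {C : Set ℕ} {m c : ℕ} (hm : m ≠ 0) {t : GTerm C}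
    (h : t.code = multipleCode m c) : c ∈ C := by
  refine ((exists_code_eq_iff _).1 ⟨t, h⟩).2 c ?_
  obtain ⟨m, rfl⟩ := Nat.exists_eq_succ_of_ne_zero hm
  change codeRec _ _ _ _ _ c (Nat.pair 3 (Nat.pair (multipleCode m c) (Nat.pair 0 c))) = true
  rw [codeRec_add, codeRec_const]
  simp

theorem eq_multipleTerm_of_code_eq {C : Set ℕ} {m c : ℕ} (hm : m ≠ 0) {t : GTerm C}
    (h : t.code = multipleCode m c) : ∃ hc : c ∈ C, t = multipleTerm m ⟨c, hc⟩ := by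
  have hc := mem_of_code_eq_multipleCode hm h
  exact ⟨hc, GTerm.code_injective (h.trans (code_multipleTerm m ⟨c, hc⟩).symm)⟩

theorem pair_zero_mem_diagram_iff {A : NatGroup} {a b : ℕ} :
    Nat.pair 0 (Nat.pair a b) ∈ A.diagram ↔
      ∃ s t : GTerm A.carrier, s.code = a ∧ t.code = b ∧ s.eval = t.eval := by
  constructor
  · rintro ⟨φ, hφ, h⟩
    cases φ with
    | eq s t =>
      rw [Literal.code, Nat.pair_eq_pair, Nat.pair_eq_pair] at h
      exact ⟨s, t, h.2.1, h.2.2, hφ⟩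
    | ne s t =>
      rw [Literal.code, Nat.pair_eq_pair] at h
      exact absurd h.1 (by omega)
  · rintro ⟨s, t, rfl, rfl, h⟩
    exact ⟨.eq s t, h, rfl⟩

variable (p : ℕ)

/-- The Gödel number of the sentence `p^(k+1) x = 0`. -/
def torsionCode (k x : ℕ) : ℕ :=
  Nat.pair 0 (Nat.pair (multipleCode (p ^ (k + 1)) x) (Nat.pair 1 0))

/-- The Gödel number of the sentence `p^k x = p^k y + p^(k+1) z`. -/
def congruenceCode (k x y z : ℕ) : ℕ :=
  Nat.pair 0 (Nat.pair (multipleCode (p ^ k) x)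
    (Nat.pair 3 (Nat.pair (multipleCode (p ^ k) y) (multipleCode (p ^ (k + 1)) z))))

/-- By stage `s` the number `k` is enumerated into `W a`. -/
def InWAt (a s k : ℕ) : Prop :=
  (Nat.Partrec.Code.evaln s (Denumerable.ofNat Nat.Partrec.Code a) k).isSome = true

theorem mem_W_iff {a k : ℕ} : k ∈ W a ↔ ∃ s, InWAt a s k := by
  rw [W, Set.mem_ofPred_eq, Part.dom_iff_mem]
  simp only [Nat.Partrec.Code.evaln_complete, InWAt, Option.isSome_iff_exists, Option.mem_def]
  exact exists_comm

theorem InWAt.mono {a s t k : ℕ} (h : InWAt a s k) (hst : s ≤ t) : InWAt a t k := by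
  obtain ⟨x, hx⟩ := Option.isSome_iff_exists.1 h
  exact Option.isSome_iff_exists.2 ⟨x, Nat.Partrec.Code.evaln_mono hst hx⟩

theorem primrecPred_inWAt : PrimrecPred fun q : ℕ × ℕ × ℕ => InWAt q.1 q.2.1 q.2.2 :=
  Primrec.eq.comp (Primrec.option_isSome.comp (Nat.Partrec.Code.primrec_evaln.comp
    (((Primrec.fst.comp Primrec.snd).pair ((Primrec.ofNat Nat.Partrec.Code).comp Primrec.fst)).pair
      (Primrec.snd.comp Primrec.snd)))) (Primrec.const true)

/-- The matrix of a `Σ⁰₂` definition of `HasSeparatedFamily` on indices of groups. -/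
def SeparatedMatrix (a k N : ℕ) (w : List ℕ × ℕ) (v : ℕ × ℕ × ℕ × ℕ) : Prop :=
  (v.1 < N → InWAt a w.2 (torsionCode p k (w.1.getI v.1))) ∧
    (v.1 < N → v.2.1 < N → v.1 ≠ v.2.1 →
      ¬InWAt a v.2.2.2 (congruenceCode p k (w.1.getI v.1) (w.1.getI v.2.1) v.2.2.1))

theorem primrecPred_separatedMatrix :
    PrimrecPred fun q : (ℕ × ℕ × ℕ) × (List ℕ × ℕ) × (ℕ × ℕ × ℕ × ℕ) =>
      SeparatedMatrix p q.1.1 q.1.2.1 q.1.2.2 q.2.1 q.2.2 := by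
  have hpow : Primrec₂ ((· ^ ·) : ℕ → ℕ → ℕ) := Primrec₂.unpaired'.1 Nat.Primrec.pow
  have ha : Primrec fun q : (ℕ × ℕ × ℕ) × (List ℕ × ℕ) × (ℕ × ℕ × ℕ × ℕ) => q.1.1 :=
    Primrec.fst.comp Primrec.fst
  have hk : Primrec fun q : (ℕ × ℕ × ℕ) × (List ℕ × ℕ) × (ℕ × ℕ × ℕ × ℕ) => p ^ q.1.2.1 :=
    hpow.comp (Primrec.const p) (Primrec.fst.comp (Primrec.snd.comp Primrec.fst))
  have hk1 : Primrec fun q : (ℕ × ℕ × ℕ) × (List ℕ × ℕ) × (ℕ × ℕ × ℕ × ℕ) => p ^ (q.1.2.1 + 1) :=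
    hpow.comp (Primrec.const p)
      (Primrec.succ.comp (Primrec.fst.comp (Primrec.snd.comp Primrec.fst)))
  have hN : Primrec fun q : (ℕ × ℕ × ℕ) × (List ℕ × ℕ) × (ℕ × ℕ × ℕ × ℕ) => q.1.2.2 :=
    Primrec.snd.comp (Primrec.snd.comp Primrec.fst)
  have hL : Primrec fun q : (ℕ × ℕ × ℕ) × (List ℕ × ℕ) × (ℕ × ℕ × ℕ × ℕ) => q.2.1.1 :=
    Primrec.fst.comp (Primrec.fst.comp Primrec.snd)
  have hs : Primrec fun q : (ℕ × ℕ × ℕ) × (List ℕ × ℕ) × (ℕ × ℕ × ℕ × ℕ) => q.2.1.2 :=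
    Primrec.snd.comp (Primrec.fst.comp Primrec.snd)
  have hv : Primrec fun q : (ℕ × ℕ × ℕ) × (List ℕ × ℕ) × (ℕ × ℕ × ℕ × ℕ) => q.2.2 :=
    Primrec.snd.comp Primrec.snd
  have hi := Primrec.fst.comp hv
  have hj := Primrec.fst.comp (Primrec.snd.comp hv)
  have hz := Primrec.fst.comp (Primrec.snd.comp (Primrec.snd.comp hv))
  have ht := Primrec.snd.comp (Primrec.snd.comp (Primrec.snd.comp hv))
  have hLi := Primrec.list_getI.comp hL hi
  have hLj := Primrec.list_getI.comp hL hj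
  have htor : Primrec fun q : (ℕ × ℕ × ℕ) × (List ℕ × ℕ) × (ℕ × ℕ × ℕ × ℕ) =>
      torsionCode p q.1.2.1 (q.2.1.1.getI q.2.2.1) :=
    Primrec₂.natPair.comp (Primrec.const 0)
      (Primrec₂.natPair.comp (primrec_multipleCode.comp hk1 hLi) (Primrec.const _))
  have hcon : Primrec fun q : (ℕ × ℕ × ℕ) × (List ℕ × ℕ) × (ℕ × ℕ × ℕ × ℕ) =>
      congruenceCode p q.1.2.1 (q.2.1.1.getI q.2.2.1) (q.2.1.1.getI q.2.2.2.1) q.2.2.2.2.1 :=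
    Primrec₂.natPair.comp (Primrec.const 0)
      (Primrec₂.natPair.comp (primrec_multipleCode.comp hk hLi)
        (Primrec₂.natPair.comp (Primrec.const 3)
          (Primrec₂.natPair.comp (primrec_multipleCode.comp hk hLj)
            (primrec_multipleCode.comp hk1 hz))))
  have hiN := Primrec.nat_lt.comp hi hN
  have hjN := Primrec.nat_lt.comp hj hN
  have hij := (Primrec.eq.comp hi hj).not
  have h1 := primrecPred_inWAt.comp (ha.pair (hs.pair htor))
  have h2 := primrecPred_inWAt.comp (ha.pair (ht.pair hcon))
  refine ((hiN.not.or h1).and (hiN.not.or (hjN.not.or (hij.not.or h2.not)))).of_eq fun q => ?_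
  simp only [SeparatedMatrix, ← imp_iff_not_or]

variable {p} [hp : Fact p.Prime] {A : NatGroup}

theorem torsionCode_mem_iff {k x : ℕ} :
    torsionCode p k x ∈ A.diagram ↔ ∃ hx : x ∈ A.carrier, p ^ (k + 1) • (⟨x, hx⟩ : A.carrier) = 0 := by
  have hp0 : ∀ m, p ^ m ≠ 0 := fun m => pow_ne_zero _ hp.out.ne_zero
  rw [torsionCode, pair_zero_mem_diagram_iff]
  constructor
  · rintro ⟨s, t, hs, ht, h⟩
    obtain ⟨hx, rfl⟩ := eq_multipleTerm_of_code_eq (hp0 _) hs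
    obtain rfl : t = .zero := GTerm.code_injective ht
    exact ⟨hx, by rw [← eval_multipleTerm, h]; rfl⟩
  · rintro ⟨hx, h⟩
    exact ⟨multipleTerm _ ⟨x, hx⟩, .zero, code_multipleTerm _ _, rfl, by
      rw [eval_multipleTerm, h]; rfl⟩

theorem congruenceCode_mem_iff {k x y z : ℕ} :
    congruenceCode p k x y z ∈ A.diagram ↔
      ∃ (hx : x ∈ A.carrier) (hy : y ∈ A.carrier) (hz : z ∈ A.carrier),
        p ^ k • (⟨x, hx⟩ : A.carrier) = p ^ k • ⟨y, hy⟩ + p ^ (k + 1) • ⟨z, hz⟩ := by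
  have hp0 : ∀ m, p ^ m ≠ 0 := fun m => pow_ne_zero _ hp.out.ne_zero
  rw [congruenceCode, pair_zero_mem_diagram_iff]
  constructor
  · rintro ⟨s, t, hs, ht, h⟩
    obtain ⟨hx, rfl⟩ := eq_multipleTerm_of_code_eq (hp0 _) hs
    have hcode := (exists_code_eq_iff _).1 ⟨t, ht⟩
    cases t with
    | const c => simp [GTerm.code, Nat.pair_eq_pair] at ht
    | zero => simp [GTerm.code, Nat.pair_eq_pair] at ht
    | neg t => simp [GTerm.code, Nat.pair_eq_pair] at ht
    | add t u =>
      simp only [GTerm.code, Nat.pair_eq_pair, true_and] at ht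
      obtain ⟨hy, rfl⟩ := eq_multipleTerm_of_code_eq (hp0 _) ht.1
      obtain ⟨hz, rfl⟩ := eq_multipleTerm_of_code_eq (hp0 _) ht.2
      simp only [GTerm.eval, eval_multipleTerm] at h
      exact ⟨hx, hy, hz, h⟩
  · rintro ⟨hx, hy, hz, h⟩
    refine ⟨multipleTerm _ ⟨x, hx⟩, .add (multipleTerm (p ^ k) ⟨y, hy⟩)
      (multipleTerm (p ^ (k + 1)) ⟨z, hz⟩),
      code_multipleTerm _ _, ?_, ?_⟩
    · rw [GTerm.code, code_multipleTerm, code_multipleTerm]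
    · simpa only [GTerm.eval, eval_multipleTerm] using h

/-- A torsion sentence in the diagram mentions its constant and so puts it into the universe; no
separate membership test is needed, even for default entries of a short list. -/
theorem hasSeparatedFamily_iff_diagram {k N : ℕ} :
    HasSeparatedFamily p A.carrier k N ↔ ∃ L : List ℕ,
      (∀ i < N, torsionCode p k (L.getI i) ∈ A.diagram) ∧
      ∀ i j z, i < N → j < N → i ≠ j →
        congruenceCode p k (L.getI i) (L.getI j) z ∉ A.diagram := by
  constructor
  · rintro ⟨y, hy, hsep⟩
    have hL : ∀ i (hi : i < N), (List.ofFn fun i => (y i : ℕ)).getI i = y ⟨i, hi⟩ := fun i hi => by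
      rw [List.getI_eq_getElem _ (by simpa using hi), List.getElem_ofFn]
    refine ⟨List.ofFn fun i => (y i : ℕ), fun i hi => ?_, fun i j z hi hj hij h => ?_⟩
    · rw [torsionCode_mem_iff, hL i hi]
      exact ⟨(y ⟨i, hi⟩).2, hy _⟩
    · rw [congruenceCode_mem_iff, hL i hi, hL j hj] at h
      obtain ⟨_, _, hz, h⟩ := h
      exact hsep ⟨i, hi⟩ ⟨j, hj⟩ (fun h => hij (Fin.mk.inj_iff.1 h)) ⟨z, hz⟩ h
  · rintro ⟨L, h1, h2⟩
    choose hx h1 using fun i : Fin N => torsionCode_mem_iff.1 (h1 i i.2)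
    exact ⟨fun i => ⟨L.getI i, hx i⟩, h1, fun i j hij z h =>
      h2 i j z i.2 j.2 (fun h => hij (Fin.ext h)) (congruenceCode_mem_iff.2 ⟨_, _, z.2, h⟩)⟩

/-- One stage witnesses the finitely many torsion sentences and is guessed together with the list; a
congruence fails iff it is never enumerated. -/
theorem hasSeparatedFamily_iff_matrix {a k N : ℕ} (ha : W a = A.diagram) :
    HasSeparatedFamily p A.carrier k N ↔ ∃ w, ∀ v, SeparatedMatrix p a k N w v := by
  rw [hasSeparatedFamily_iff_diagram, ← ha]
  simp only [mem_W_iff]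
  constructor
  · rintro ⟨L, h1, h2⟩
    choose! s hs using h1
    refine ⟨(L, (Finset.range N).sup s), fun ⟨i, j, z, t⟩ => ⟨fun hi => ?_, fun hi hj hij h => ?_⟩⟩
    · exact (hs i hi).mono (Finset.le_sup (Finset.mem_range.2 hi))
    · exact h2 i j z hi hj hij ⟨t, h⟩
  · rintro ⟨⟨L, s⟩, h⟩
    exact ⟨L, fun i hi => ⟨s, (h (i, 0, 0, 0)).1 hi⟩, fun i j z hi hj hij ⟨t, ht⟩ =>
      (h (i, j, z, t)).2 hi hj hij ht⟩

end DiagramFormulas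

/-! ### Completeness of the isomorphism problem -/

section IsomorphismProblem

variable (p : ℕ)

/-- The matrix of a `Π⁰₃` definition of isomorphism on pairs of indices. -/
def IsoMatrix (q : ℕ × ℕ) (x : ℕ × (ℕ × ℕ) × (List ℕ × ℕ))
    (y : ℕ × (List ℕ × ℕ) × (ℕ × ℕ × ℕ × ℕ)) (z : ℕ × ℕ × ℕ × ℕ) : Prop :=
  (y.1 = 0 ∧ ¬SeparatedMatrix p (if x.1 = 0 then q.1 else q.2) x.2.1.1 x.2.1.2 x.2.2 y.2.2) ∨
    (y.1 = 1 ∧ SeparatedMatrix p (if x.1 = 0 then q.2 else q.1) x.2.1.1 x.2.1.2 y.2.1 z)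

/-- A `Π⁰₃` definition of isomorphism on pairs of indices. -/
def isoRelation : Set (ℕ × ℕ) := {q | ∀ x, ∃ y, ∀ z, IsoMatrix p q x y z}

theorem mem_isoRelation_iff {a b : ℕ} : (a, b) ∈ isoRelation p ↔
    ∀ k N, (∃ w, ∀ v, SeparatedMatrix p a k N w v) ↔ ∃ w, ∀ v, SeparatedMatrix p b k N w v := by
  -- Prenex form of an implication between `∃∀` conditions: `y` either refutes the proposed `w` (tag
  -- `0`) or supplies a witness for the conclusion (tag `1`).
  have key : ∀ c d k N, (∀ w, ∃ y : ℕ × (List ℕ × ℕ) × (ℕ × ℕ × ℕ × ℕ), ∀ z,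
      (y.1 = 0 ∧ ¬SeparatedMatrix p c k N w y.2.2) ∨
        (y.1 = 1 ∧ SeparatedMatrix p d k N y.2.1 z)) ↔
      ((∃ w, ∀ v, SeparatedMatrix p c k N w v) → ∃ w, ∀ v, SeparatedMatrix p d k N w v) := by
    intro c d k N
    constructor
    · rintro h ⟨w, hw⟩
      obtain ⟨y, hy⟩ := h w
      exact ⟨y.2.1, fun z => ((hy z).resolve_left fun h => h.2 (hw _)).2⟩
    · intro h w
      by_cases hw : ∀ v, SeparatedMatrix p c k N w v
      · obtain ⟨w', hw'⟩ := h ⟨w, hw⟩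
        exact ⟨(1, w', 0), fun z => Or.inr ⟨rfl, hw' z⟩⟩
      · push Not at hw
        obtain ⟨v, hv⟩ := hw
        exact ⟨(0, w, v), fun z => Or.inl ⟨rfl, hv⟩⟩
  rw [isoRelation, Set.mem_ofPred_eq]
  constructor
  · exact fun h k N => ⟨(key a b k N).1 fun w => h (0, (k, N), w),
      (key b a k N).1 fun w => h (1, (k, N), w)⟩
  · rintro h ⟨d, ⟨k, N⟩, w⟩
    match d with
    | 0 => exact (key a b k N).2 (h k N).1 w
    | d + 1 => exact (key b a k N).2 (h k N).2 w

theorem primrecPred_isoMatrix : PrimrecPred fun q : (ℕ × ℕ) × (ℕ × (ℕ × ℕ) × (List ℕ × ℕ)) ×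
    (ℕ × (List ℕ × ℕ) × (ℕ × ℕ × ℕ × ℕ)) × (ℕ × ℕ × ℕ × ℕ) =>
      IsoMatrix p q.1 q.2.1 q.2.2.1 q.2.2.2 := by
  let T := (ℕ × ℕ) × (ℕ × (ℕ × ℕ) × (List ℕ × ℕ)) × (ℕ × (List ℕ × ℕ) × (ℕ × ℕ × ℕ × ℕ)) ×
    (ℕ × ℕ × ℕ × ℕ)
  have hx : Primrec fun q : T => q.2.1 := Primrec.fst.comp Primrec.snd
  have hy : Primrec fun q : T => q.2.2.1 := Primrec.fst.comp (Primrec.snd.comp Primrec.snd)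
  have hz : Primrec fun q : T => q.2.2.2 := Primrec.snd.comp (Primrec.snd.comp Primrec.snd)
  have hq1 : Primrec fun q : T => q.1.1 := Primrec.fst.comp Primrec.fst
  have hq2 : Primrec fun q : T => q.1.2 := Primrec.snd.comp Primrec.fst
  have hd : PrimrecPred fun q : T => q.2.1.1 = 0 :=
    Primrec.eq.comp (Primrec.fst.comp hx) (Primrec.const 0)
  have hkN := Primrec.fst.comp (Primrec.snd.comp hx)
  have hw := Primrec.snd.comp (Primrec.snd.comp hx)
  have hy1 := Primrec.fst.comp hy
  have hy2 := Primrec.fst.comp (Primrec.snd.comp hy)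
  have hy3 := Primrec.snd.comp (Primrec.snd.comp hy)
  have h1 := (primrecPred_separatedMatrix p).comp
    (((Primrec.ite hd hq1 hq2).pair hkN).pair (hw.pair hy3))
  have h2 := (primrecPred_separatedMatrix p).comp
    (((Primrec.ite hd hq2 hq1).pair hkN).pair (hy2.pair hz))
  exact ((Primrec.eq.comp hy1 (Primrec.const 0)).and h1.not).or
    ((Primrec.eq.comp hy1 (Primrec.const 1)).and h2)

theorem isPi03_isoRelation : IsPi03 (isoRelation p) :=
  isPi03_of_primrecPred (primrecPred_isoMatrix p)

variable {p} [Fact p.Prime]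

theorem nonempty_equiv_iff_mem_isoRelation {A B : NatGroup} (hA : A ∈ KOmega p) (hB : B ∈ KOmega p)
    {a b : ℕ} (ha : IsIndexOf a A) (hb : IsIndexOf b B) :
    Nonempty (A.carrier ≃+ B.carrier) ↔ (a, b) ∈ isoRelation p := by
  obtain ⟨hA1, hA2⟩ := isReducedPGroupOfLengthLeOmega_iff.1 hA.2
  obtain ⟨hB1, hB2⟩ := isReducedPGroupOfLengthLeOmega_iff.1 hB.2
  rw [nonempty_addEquiv_iff hA1 hA2 hB1 hB2, mem_isoRelation_iff]
  simp only [hasSeparatedFamily_iff_matrix ha.2, hasSeparatedFamily_iff_matrix hb.2]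

variable (p)

theorem isPi03Within_isoProblem :
    IsPi03Within (isoProblem (KOmega p)) (indexSet (KOmega p) ×ˢ indexSet (KOmega p)) := by
  refine ⟨isoRelation p, isPi03_isoRelation p, Set.ext fun ⟨a, b⟩ => ?_⟩
  constructor
  · rintro ⟨A, hA, B, hB, ha, hb, h⟩
    exact ⟨(nonempty_equiv_iff_mem_isoRelation hA hB ha hb).1 h, ⟨A, hA, ha⟩, ⟨B, hB, hb⟩⟩
  · rintro ⟨h, ⟨A, hA, ha⟩, ⟨B, hB, hb⟩⟩
    exact ⟨A, hA, B, hB, ha, hb, (nonempty_equiv_iff_mem_isoRelation hA hB ha hb).2 h⟩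

/-- Indices of the members of a uniformly computable sequence can be computed. -/
theorem exists_computable_index_of_uniform {H : ℕ → NatGroup} (hH : UniformlyComputableIn ∅ H) :
    ∃ f : ℕ → ℕ, Computable f ∧ ∀ n, IsIndexOf (f n) (H n) := by
  obtain ⟨f, hf, hW⟩ := exists_computable_index (P := fun n k => k ∈ (H n).diagram)
    (uniformlyComputableIn_empty hH)
  exact ⟨f, hf, fun n => ⟨isComputable_of_uniform hH n, hW n⟩⟩

theorem reducibleWithin_isoProblem {S : Set ℕ} (hS : IsPi03 S) :
    ReducibleWithin S (isoProblem (KOmega p)) (indexSet (KOmega p) ×ˢ indexSet (KOmega p)) := by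
  obtain ⟨H, hH, hHr, hHS⟩ := exists_uniform_sequence p ∅ S (hS.isPi03In ∅)
  have huniv : IsPi03In ∅ (Set.univ : Set ℕ) :=
    ⟨fun _ => True, ((PrimrecPred.computablePredIn
      (Primrec.eq.comp (Primrec.const 0) (Primrec.const 0))).of_eq fun _ => by simp), by simp⟩
  -- For the set of all numbers the construction yields only copies of `G^ω`; one of them serves as
  -- the fixed second component.
  obtain ⟨H', hH', hHr', hHS'⟩ := exists_uniform_sequence p ∅ Set.univ huniv
  obtain ⟨f, hf, hfH⟩ := exists_computable_index_of_uniform hH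
  obtain ⟨f', -, hfH'⟩ := exists_computable_index_of_uniform hH'
  have hK : ∀ n, H n ∈ KOmega p := fun n => ⟨isComputable_of_uniform hH n, hHr n⟩
  have hK' : H' 0 ∈ KOmega p := ⟨isComputable_of_uniform hH' 0, hHr' 0⟩
  obtain ⟨e⟩ := (hHS' 0).2 trivial
  refine ⟨fun n => (f n, f' 0), hf.pair (Computable.const _),
    fun n => ⟨⟨H n, hK n, hfH n⟩, ⟨H' 0, hK', hfH' 0⟩⟩, fun n => ?_⟩
  rw [← hHS]
  constructor
  · rintro ⟨g⟩
    exact ⟨H n, hK n, H' 0, hK', hfH n, hfH' 0, ⟨g.trans e.symm⟩⟩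
  · rintro ⟨A, hA, B, hB, ha, hb, h⟩
    -- `A` and `B` are merely some groups with these indices. As `isoRelation` depends on the
    -- indices alone, the isomorphism transfers to `H n` and `H' 0`.
    obtain ⟨g⟩ := (nonempty_equiv_iff_mem_isoRelation (hK n) hK' (hfH n) (hfH' 0)).2
      ((nonempty_equiv_iff_mem_isoRelation hA hB ha hb).1 h)
    exact ⟨g.trans e⟩

end IsomorphismProblem

end UlmGroups

end

theorem mainTheorem3 (p : ℕ) [Fact p.Prime] :
    -- `E(K_ω)` is `Π⁰₃` complete within `K_ω`, that is, within `I(K_ω) × I(K_ω)`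
    UlmGroups.IsPi03CompleteWithin
      (UlmGroups.isoProblem (UlmGroups.KOmega p))
      (UlmGroups.indexSet (UlmGroups.KOmega p) ×ˢ UlmGroups.indexSet (UlmGroups.KOmega p)) ∧
    -- `G^ω` is a countable reduced Abelian `p`-group with `u_β = ℵ₀` if `β < ω`, else `u_β = 0`
    (Countable (UlmGroups.GOmega p) ∧
      UlmGroups.IsAbelianPGroup p (UlmGroups.GOmega p) ∧
      UlmGroups.IsReducedGroup p (UlmGroups.GOmega p) ∧
      (∀ β : Ordinal.{0}, β < Ordinal.omega0 →
        UlmGroups.ulmInvariant p (UlmGroups.GOmega p) β = Cardinal.aleph0) ∧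
      (∀ β : Ordinal.{0}, Ordinal.omega0 ≤ β →
        UlmGroups.ulmInvariant p (UlmGroups.GOmega p) β = 0)) ∧
    -- the uniform relativized version
    (∀ (X S : Set ℕ), UlmGroups.IsPi03In X S →
      ∃ H : ℕ → UlmGroups.NatGroup,
        UlmGroups.UniformlyComputableIn X H ∧
        (∀ n, UlmGroups.IsReducedPGroupOfLengthLeOmega p (H n).carrier) ∧
        ∀ n, Nonempty ((H n).carrier ≃+ UlmGroups.GOmega p) ↔ n ∈ S) := by
  have hcount : Countable (UlmGroups.GOmega p) := UlmGroups.countable_cyclicSum _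
  have hp : UlmGroups.IsAbelianPGroup p (UlmGroups.GOmega p) :=
    UlmGroups.isAbelianPGroup_cyclicSum _
  have hsep : UlmGroups.IsPSeparated p (UlmGroups.GOmega p) := UlmGroups.isPSeparated_cyclicSum _
  refine ⟨⟨UlmGroups.isPi03Within_isoProblem p, fun S => UlmGroups.reducibleWithin_isoProblem p⟩,
    ⟨hcount, hp, (UlmGroups.isReducedPGroupOfLengthLeOmega_iff.2 ⟨hp, hsep⟩).2.1, fun β hβ => ?_,
      fun β => UlmGroups.ulmInvariant_eq_zero hsep⟩, UlmGroups.exists_uniform_sequence p⟩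
  obtain ⟨k, rfl⟩ := Ordinal.lt_omega0.1 hβ
  exact UlmGroups.ulmInvariant_eq_aleph0 (UlmGroups.hasSeparatedFamily_gOmega k)
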